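/- Let $d$ be a positive integer, let $m_d$ be the normalized Haar measure on the torus $\mathbb{T}^d$, and let $H^2(\mathbb{T}^d)$ be the space of all $f\in L^2(\mathbb{T}^d)$ whose Fourier coefficients $\widehat f(\alpha)=\int_{\mathbb{T}^d} f(z)\overline{z^\alpha}\,dm_d(z)$ vanish for every $\alpha\in\mathbb{Z}^d$ with a negative entry. Let $P\colon L^2(\mathbb{T}^d)\to H^2(\mathbb{T}^d)$ be the orthogonal (Riesz) projection, and let $H^2_1(\mathbb{T}^d)\subset H^2(\mathbb{T}^d)$ be the subspace of $1$-homogeneous polynomials $\sum_{j=1}^d c_j z_j$ with $c_j\in\mathbb{C}$, with the norm of $L^2(\mathbb{T}^d)$. For $2<p<\infty$ define the normalized nonlinear projection $$\mathscr{P}_p(\varphi)=\frac{P(|\varphi|^{p-2}\varphi)}{\|P(|\varphi|^{p-2}\varphi)\|_{L^2(\mathbb{T}^d)}}.$$ **Theorem.** Fix $2<p<\infty$. Suppose that $\varphi_0(z)=\sum_{j=1}^d c_j z_j$ lies in the unit sphere of $H^2_1(\mathbb{T}^d)$ and that $c_j\neq 0$ for $j=1,\dots,d$. Then all iterates $\mathscr{P}_p^n\varphi_0$,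 $n\ge 0$, are well defined and lie in the unit sphere of $H^2_1(\mathbb{T}^d)$, and $$\lim_{n\to\infty}\mathscr{P}_p^n\varphi_0=\frac{1}{\sqrt d}\sum_{j=1}^d\frac{c_j}{|c_j|}\,z_j$$ in the norm of $L^2(\mathbb{T}^d)$ (equivalently, coefficient by coefficient). -/

import Mathlib

open MeasureTheory Filter Topology

noncomputable section

namespace HilbertPoints

/-- The `d`-dimensional torus `𝕋^d`, written additively: the point `x` in `(ℝ/ℤ)^d` stands for
`z = (exp (2πi x₁), …, exp (2πi x_d))`. -/
abbrev Torus (d : ℕ) : Type := UnitAddTorus (Fin d)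

/-- The normalized Haar measure `m_d` on `𝕋^d`. -/
abbrev haarTorus (d : ℕ) : Measure (Torus d) :=
  Measure.pi fun _ => AddCircle.haarAddCircle

/-- The space `L²(𝕋^d)` of complex functions with respect to `m_d`. -/
abbrev L2 (d : ℕ) : Type := Lp ℂ 2 (haarTorus d)

/-- The monomial `z ↦ z^α = z₁^{α₁} ⋯ z_d^{α_d}` in `L²(𝕋^d)`, for `α` in `ℤ^d`. -/
def monomial {d : ℕ} (α : Fin d → ℤ) : L2 d := UnitAddTorus.mFourierLp 2 α

/-- The Fourier coefficient `∫ f(z) conj(z^α) dm_d(z)`. -/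
def fourierCoefficient {d : ℕ} (f : Torus d → ℂ) (α : Fin d → ℤ) : ℂ :=
  ∫ z, f z * (starRingEnd ℂ) (UnitAddTorus.mFourier α z) ∂(haarTorus d)

theorem fourierCoefficient_eq_inner {d : ℕ} (f : L2 d) (α : Fin d → ℤ) :
    fourierCoefficient (f : Torus d → ℂ) α = inner ℂ (monomial α) f := by
  rw [L2.inner_def]
  refine integral_congr_ae ?_
  filter_upwards [UnitAddTorus.coeFn_mFourierLp 2 α] with z hz
  simp only [RCLike.inner_apply]
  unfold monomial
  erw [hz]

/-- The Hardy space `H²(𝕋^d)`: the functions in `L²(𝕋^d)` whose Fourier coefficients vanish at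
every `α` in `ℤ^d` with a negative entry. -/
def hardySpace (d : ℕ) : Submodule ℂ (L2 d) where
  carrier := {f | ∀ α : Fin d → ℤ, (∃ j, α j < 0) →
    fourierCoefficient (f : Torus d → ℂ) α = 0}
  add_mem' {f g} hf hg α hα := by
    have h1 := hf α hα
    have h2 := hg α hα
    rw [fourierCoefficient_eq_inner] at h1 h2 ⊢
    rw [inner_add_right, h1, h2, add_zero]
  zero_mem' α _ := by
    rw [fourierCoefficient_eq_inner, inner_zero_right]
  smul_mem' c f hf α hα := by
    have h1 := hf α hα
    rw [fourierCoefficient_eq_inner] at h1 ⊢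
    rw [inner_smul_right, h1, mul_zero]

theorem isClosed_hardySpace (d : ℕ) : IsClosed (hardySpace d : Set (L2 d)) := by
  have h : (hardySpace d : Set (L2 d)) =
      ⋂ (α : Fin d → ℤ) (_ : ∃ j, α j < 0), {f : L2 d | inner ℂ (monomial α) f = 0} := by
    ext f
    simp only [Set.mem_iInter, Set.mem_ofPred_eq, ← fourierCoefficient_eq_inner]
    rfl
  rw [h]
  refine isClosed_iInter fun α => isClosed_iInter fun _ => ?_
  exact isClosed_eq (continuous_const.inner continuous_id) continuous_const

instance completeSpace_hardySpace (d : ℕ) : CompleteSpace (hardySpace d) :=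
  (isClosed_hardySpace d).completeSpace_coe

/-- The Riesz projection: the orthogonal projection of `L²(𝕋^d)` onto `H²(𝕋^d)`. -/
def rieszProjection (d : ℕ) : L2 d →L[ℂ] L2 d := (hardySpace d).starProjection

/-- The coordinate function `z ↦ z_j`. -/
def coordinate {d : ℕ} (j : Fin d) : L2 d := monomial (Pi.single j 1)

/-- The space `H²₁(𝕋^d)` of `1`-homogeneous polynomials, with the norm of `L²(𝕋^d)`. -/
def oneHomogeneous (d : ℕ) : Submodule ℂ (L2 d) :=
  Submodule.span ℂ (Set.range (coordinate (d := d)))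

/-- The function `|φ|^{p-2} φ`. -/
def powerFunction {d : ℕ} (p : ℝ) (φ : Torus d → ℂ) : Torus d → ℂ :=
  fun z => ((‖φ z‖ ^ (p - 2) : ℝ) : ℂ) * φ z

open Classical in
/-- The normalized nonlinear projection `P(|φ|^{p-2} φ) / ‖P(|φ|^{p-2} φ)‖₂`. It is meaningful when
`|φ|^{p-2} φ` is in `L²(𝕋^d)` and its Riesz projection is nonzero; otherwise its value here is `0`,
which is not on the unit sphere. -/
def nonlinearProjection {d : ℕ} (p : ℝ) (φ : L2 d) : L2 d :=
  if h : MemLp (powerFunction p (φ : Torus d → ℂ)) 2 (haarTorus d) then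
    ((‖rieszProjection d (h.toLp _)‖⁻¹ : ℝ) : ℂ) • rieszProjection d (h.toLp _)
  else 0

end HilbertPoints

end

noncomputable section

namespace HilbertPoints

open AddCircle
open scoped ComplexConjugate

/-! ### Parseval's identity and the binomial series on the circle -/

/-! Rotating all variables together shows that the Riesz projection of `|φ|^{p-2} φ` is again
1-homogeneous, and averaging over the phase of `z_j` shows that its `j`-th coefficient is `c_j`
times a factor that is positive when `c_j ≠ 0` (`rieszProjection_powerFunction`, `projCoeff_eq`).
Phases are therefore preserved, and only the moduli `|c_j|` evolve.

Two comparisons govern the moduli. The larger of two coefficients stays the larger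
(`norm_mul_growthFactor_le`), but if it is strictly larger its factor is strictly smaller
(`growthFactor_lt`). Hence each ratio `|c_j| / |c_k| ≥ 1` decreases and stays at least `1`. Its
limit is attained at a cluster point of the orbit and also at the image of that point, so strict
decrease forces the limit to be `1`; the unit norm then makes every modulus tend to `1/√d`.

The strict comparison rests on one fact about the circle: the mean of `conj ζ |ζu + w|^{p-2} (ζu +
w)` is `k(|u|,|w|) u`, with `k` strictly increasing in `|u|` (`circleMean_eq`, `circleFactor_lt`).
Take `u = c_j z_j + c_k z_k`, `w` the remaining terms and `θ = Re (c_j z_j conj (c_k z_k))`. The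
difference of the two factors is a negative multiple of `∫ k(|u|,|w|) θ`. Since `|u|²` is a constant
plus `2θ`, and `z_j ↦ -z_j` changes the sign of `θ` but fixes `w`, pairing each point with its image
makes this integral positive.

Monotonicity of `k` reduces by homogeneity to `|w| = 1`, where Parseval's identity and the binomial
series expand `k`. For `|u| < 1` it is a power series with nonnegative coefficients. For `|u| > 1`
at most one term is decreasing, and its predecessor compensates for it. Continuity bridges `|u| =
1`. -/

theorem integral_fourier_mul_fourier (m n : ℤ) :
    ∫ t : UnitAddCircle, fourier m t * conj (fourier n t) ∂haarAddCircle = if m = n then 1 else 0 := by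
  have h := orthonormal_iff_ite.mp (orthonormal_fourier (T := (1 : ℝ))) n m
  rw [ContinuousMap.inner_toLp] at h
  rw [h]
  simp only [eq_comm]

theorem norm_fourier_apply (n : ℤ) (t : UnitAddCircle) : ‖fourier n t‖ = 1 := by
  rw [fourier_apply]
  exact Circle.norm_coe _

theorem hasSum_integral_mul_fourier_series {a : ℕ → ℂ} (ha : Summable fun n => ‖a n‖)
    {F A : UnitAddCircle → ℂ} (hF : Continuous F)
    (hA : ∀ t, HasSum (fun n : ℕ => a n * fourier (n : ℤ) t) (A t)) :
    HasSum (fun n : ℕ => a n * ∫ t, F t * fourier (n : ℤ) t ∂haarAddCircle)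
      (∫ t, F t * A t ∂haarAddCircle) := by
  obtain ⟨C, hC⟩ := isCompact_univ.exists_bound_of_continuousOn (hF.continuousOn (s := Set.univ))
  have hint : ∀ n : ℕ, Integrable (fun t => F t * (a n * fourier (n : ℤ) t)) haarAddCircle :=
    fun n => Continuous.integrable_of_hasCompactSupport (by fun_prop)
      (HasCompactSupport.of_compactSpace _)
  have key := hasSum_integral_of_summable_integral_norm (μ := haarAddCircle) hint ?_
  · have hv : ∫ t, F t * A t ∂haarAddCircle =
        ∫ t, ∑' n : ℕ, F t * (a n * fourier (n : ℤ) t) ∂haarAddCircle := by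
      congr 1; ext t
      rw [tsum_mul_left, (hA t).tsum_eq]
    rw [hv]
    refine key.congr_fun fun n => ?_
    rw [← integral_const_mul]
    congr 1; ext t; ring
  · refine Summable.of_nonneg_of_le (fun n => integral_nonneg fun t => norm_nonneg _) (fun n => ?_)
      (ha.mul_left C)
    calc ∫ t, ‖F t * (a n * fourier (n : ℤ) t)‖ ∂haarAddCircle
        ≤ ∫ t : UnitAddCircle, C * ‖a n‖ ∂haarAddCircle := by
          refine integral_mono (hint n).norm (integrable_const _) fun t => ?_
          simp only [norm_mul, norm_fourier_apply, mul_one]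
          exact mul_le_mul_of_nonneg_right (hC t trivial) (norm_nonneg _)
      _ = C * ‖a n‖ := by simp

theorem continuous_of_hasSum_fourier {a : ℕ → ℂ} (ha : Summable fun n => ‖a n‖)
    {A : UnitAddCircle → ℂ}
    (hA : ∀ t, HasSum (fun n : ℕ => a n * fourier (n : ℤ) t) (A t)) : Continuous A := by
  have : A = fun t => ∑' n : ℕ, a n * fourier (n : ℤ) t := funext fun t => (hA t).tsum_eq.symm
  rw [this]
  refine continuous_tsum (fun n => by fun_prop) ha fun n t => ?_
  rw [norm_mul, norm_fourier_apply, mul_one]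

/-- Parseval's identity for two absolutely convergent one-sided Fourier series, one of them
shifted. -/
theorem hasSum_integral_fourier_series_mul_conj {a b : ℕ → ℂ} (ha : Summable fun n => ‖a n‖)
    (hb : Summable fun n => ‖b n‖) {A B : UnitAddCircle → ℂ}
    (hA : ∀ t, HasSum (fun n : ℕ => a n * fourier (n : ℤ) t) (A t))
    (hB : ∀ t, HasSum (fun n : ℕ => b n * fourier (n : ℤ) t) (B t)) (m : ℕ) :
    HasSum (fun n : ℕ => a (n + m) * conj (b n))
      (∫ t, conj (fourier (m : ℤ) t) * A t * conj (B t) ∂haarAddCircle) := by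
  have hBc := continuous_of_hasSum_fourier hb hB
  have hAc := continuous_of_hasSum_fourier ha hA
  have coef : ∀ k : ℕ, ∫ t, conj (A t) * fourier (k : ℤ) t ∂haarAddCircle = conj (a k) := by
    intro k
    have h1 := hasSum_integral_mul_fourier_series ha
      (F := fun t : UnitAddCircle => conj (fourier (k : ℤ) t)) (by fun_prop) hA
    have h2 : HasSum (fun n : ℕ => a n * ∫ t : UnitAddCircle,
        conj (fourier (k : ℤ) t) * fourier (n : ℤ) t ∂haarAddCircle) (a k) := by
      refine (hasSum_ite_eq k (a k)).congr_fun fun n => ?_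
      simp_rw [mul_comm (conj _), integral_fourier_mul_fourier]
      by_cases h : n = k <;> simp [h]
    rw [h2.unique h1, ← integral_conj]
    congr 1; ext t
    rw [map_mul, Complex.conj_conj, mul_comm]
  have h1 := hasSum_integral_mul_fourier_series hb
    (F := fun t : UnitAddCircle => conj (A t) * fourier (m : ℤ) t) (by fun_prop) hB
  have h2 := (RCLike.hasSum_conj' ℂ).mpr h1
  have hv : ∫ t, conj (fourier (m : ℤ) t) * A t * conj (B t) ∂haarAddCircle =
      conj (∫ t, conj (A t) * fourier (m : ℤ) t * B t ∂haarAddCircle) := by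
    rw [← integral_conj]
    congr 1; ext t
    simp only [map_mul, Complex.conj_conj]
    ring
  rw [hv]
  refine h2.congr_fun fun n => ?_
  have : ∀ t : UnitAddCircle, conj (A t) * fourier (m : ℤ) t * fourier (n : ℤ) t =
      conj (A t) * fourier ((n + m : ℕ) : ℤ) t := by
    intro t; push_cast; rw [fourier_add]; ring
  simp_rw [this, coef]
  rw [map_mul, Complex.conj_conj, mul_comm]

theorem summable_norm_choose_mul_pow (α : ℝ) {x : ℝ} (hx0 : 0 ≤ x) (hx1 : x < 1) :
    Summable fun n : ℕ => ‖((Ring.choose α n * x ^ n : ℝ) : ℂ)‖ := by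
  have h := (Complex.one_add_cpow_hasFPowerSeriesOnBall_zero (a := (α : ℂ)))
  have := (binomialSeries ℂ (α : ℂ)).summable_norm_apply (x := (x : ℂ)) ?_
  · refine this.congr fun n => ?_
    rw [binomialSeries_apply, ← Complex.ofReal_choose]
    simp
  · refine Metric.eball_subset_eball h.r_le ?_
    simp only [Metric.mem_eball, edist_zero_right, enorm_eq_nnnorm]
    rw [← ENNReal.coe_one, ENNReal.coe_lt_coe, ← NNReal.coe_lt_coe]
    simpa [abs_of_nonneg hx0] using hx1

theorem hasSum_choose_mul_fourier (α : ℝ) {x : ℝ} (hx0 : 0 ≤ x) (hx1 : x < 1)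
    (t : UnitAddCircle) :
    HasSum (fun n : ℕ => ((Ring.choose α n * x ^ n : ℝ) : ℂ) * fourier (n : ℤ) t)
      ((1 + x * fourier 1 t) ^ (α : ℂ)) := by
  have h := (Complex.one_add_cpow_hasFPowerSeriesOnBall_zero (a := (α : ℂ)))
  have := h.hasSum (y := (x : ℂ) * fourier 1 t) ?_
  · simp only [zero_add] at this
    refine this.congr_fun fun n => ?_
    have h2 : (fourier (n : ℤ) t : ℂ) = (fourier 1 t) ^ n := by
      simp [fourier_apply, AddCircle.toCircle_nsmul]
    rw [binomialSeries_apply, ← Complex.ofReal_choose, h2]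
    simp only [List.ofFn_const, List.prod_replicate, smul_eq_mul, mul_pow]
    push_cast
    ring
  · simp only [Metric.mem_eball, edist_zero_right, enorm_eq_nnnorm]
    rw [← ENNReal.coe_one, ENNReal.coe_lt_coe, ← NNReal.coe_lt_coe, coe_nnnorm, norm_mul,
      norm_fourier_apply]
    simpa [abs_of_nonneg hx0] using hx1

/-- Used with `α = p/2`, `β = p/2 - 1`: the shift `m = 1` serves `ρ < 1`, and `m = 0` with `x = ρ⁻¹`
serves `ρ > 1`. -/
theorem hasSum_integral_binomial (α β : ℝ) {x : ℝ} (hx0 : 0 ≤ x) (hx1 : x < 1) (m : ℕ) :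
    HasSum (fun n : ℕ => Ring.choose α (n + m) * Ring.choose β n * x ^ (2 * n + m))
      (∫ t : UnitAddCircle, conj (fourier (m : ℤ) t) * (1 + x * fourier 1 t) ^ (α : ℂ) *
        conj ((1 + x * fourier 1 t) ^ (β : ℂ)) ∂haarAddCircle).re := by
  have h := hasSum_integral_fourier_series_mul_conj (summable_norm_choose_mul_pow α hx0 hx1)
    (summable_norm_choose_mul_pow β hx0 hx1) (hasSum_choose_mul_fourier α hx0 hx1)
    (hasSum_choose_mul_fourier β hx0 hx1) m
  have h2 := Complex.hasSum_re h
  refine h2.congr_fun fun n => ?_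
  rw [Complex.conj_ofReal, ← Complex.ofReal_mul, Complex.ofReal_re]
  ring

/-! ### Recurrences for real binomial coefficients -/

theorem choose_succ_mul (α : ℝ) (n : ℕ) :
    ((n : ℝ) + 1) * Ring.choose α (n + 1) = (α - n) * Ring.choose α n := by
  have h1 := Ring.descPochhammer_eq_factorial_smul_choose α n
  have h2 := Ring.descPochhammer_eq_factorial_smul_choose α (n + 1)
  rw [descPochhammer_succ_right, Polynomial.smeval_mul, h1] at h2
  simp [Polynomial.smeval_natCast, Nat.factorial_succ] at h2
  have h3 : (n.factorial : ℝ) ≠ 0 := by positivity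
  apply mul_left_cancel₀ h3
  linarith

theorem choose_succ_eq (α : ℝ) (n : ℕ) :
    ((n : ℝ) + 1) * Ring.choose α (n + 1) = α * Ring.choose (α - 1) n := by
  induction n with
  | zero => simp
  | succ n ih =>
    have h1 := choose_succ_mul α (n + 1)
    have h2 := choose_succ_mul (α - 1) n
    push_cast at h1 ⊢
    have h3 : ((n : ℝ) + 1) ≠ 0 := by positivity
    apply mul_left_cancel₀ h3
    rw [h1]
    linear_combination (α - (n + 1)) * ih - α * h2

/-! ### The power map and its circle means -/

/-- The map `s ↦ |s|^{p-2} s` on the complex plane. -/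
def powerMap (p : ℝ) (s : ℂ) : ℂ := ((‖s‖ ^ (p - 2) : ℝ) : ℂ) * s

theorem continuous_powerMap {p : ℝ} (hp : 2 < p) : Continuous (powerMap p) := by
  unfold powerMap
  have : Continuous fun s : ℂ => ‖s‖ ^ (p - 2) :=
    continuous_norm.rpow_const fun _ => Or.inr (by linarith)
  fun_prop

theorem powerMap_mul_of_norm_one (p : ℝ) {a : ℂ} (ha : ‖a‖ = 1) (s : ℂ) :
    powerMap p (a * s) = a * powerMap p s := by
  unfold powerMap
  rw [norm_mul, ha, one_mul]
  ring

theorem powerMap_conj (p : ℝ) (s : ℂ) : powerMap p (conj s) = conj (powerMap p s) := by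
  simp [powerMap]

theorem powerMap_real_mul (p : ℝ) {r : ℝ} (hr : 0 < r) (s : ℂ) :
    powerMap p (r * s) = ((r ^ (p - 2) * r : ℝ) : ℂ) * powerMap p s := by
  unfold powerMap
  rw [norm_mul, Complex.norm_real, Real.norm_of_nonneg hr.le,
    Real.mul_rpow hr.le (norm_nonneg _)]
  push_cast
  ring

/-- Splits the power map into a holomorphic and an antiholomorphic factor, each with a binomial
series, so that Parseval's identity applies. -/
theorem powerMap_eq_cpow (p : ℝ) {s : ℂ} (hs : s ≠ 0) :
    powerMap p s = s ^ ((p / 2 : ℝ) : ℂ) * conj (s ^ ((p / 2 - 1 : ℝ) : ℂ)) := by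
  have h1 : s ^ ((p / 2 : ℝ) : ℂ) = s ^ ((p / 2 - 1 : ℝ) : ℂ) * s := by
    rw [show ((p / 2 : ℝ) : ℂ) = ((p / 2 - 1 : ℝ) : ℂ) + 1 by push_cast; ring,
      Complex.cpow_add _ _ hs, Complex.cpow_one]
  rw [h1, mul_right_comm, Complex.mul_conj, Complex.normSq_eq_norm_sq, Complex.norm_cpow_real,
    powerMap, ← Real.rpow_natCast, ← Real.rpow_mul (norm_nonneg _)]
  congr 4
  push_cast
  ring

/-- The mean over the circle of `conj (ζ) |ζ u + w|^{p-2} (ζ u + w)`. -/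
def circleMean (p : ℝ) (u w : ℂ) : ℂ :=
  ∫ t : UnitAddCircle, powerMap p (fourier 1 t * u + w) * conj (fourier 1 t) ∂haarAddCircle

theorem continuous_circleMean {p : ℝ} (hp : 2 < p) :
    Continuous fun x : ℂ × ℂ => circleMean p x.1 x.2 := by
  have hg := continuous_powerMap hp
  have : Continuous (Function.uncurry fun (x : ℂ × ℂ) (t : UnitAddCircle) =>
      powerMap p (fourier 1 t * x.1 + x.2) * conj (fourier 1 t)) := by
    simp only [Function.uncurry_def]
    fun_prop
  have h2 := continuous_parametric_integral_of_continuous (μ := haarAddCircle) this isCompact_univ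
  simp only [Measure.restrict_univ] at h2
  exact h2

theorem continuous_circleMean_comp {X : Type*} [TopologicalSpace X] {p : ℝ} (hp : 2 < p)
    {u w : X → ℂ} (hu : Continuous u) (hw : Continuous w) :
    Continuous fun x => circleMean p (u x) (w x) := by
  have h := (continuous_circleMean hp).comp (hu.prodMk hw)
  exact h

/-- The factor `k` in `circleMean p u w = k (|u|, |w|) u`. -/
def circleFactor (p ρ R : ℝ) : ℝ := (circleMean p ρ R).re / ρ

/-! ### Strict monotonicity of the circle factor -/

theorem choose_pos {α : ℝ} {n : ℕ} (h : (n : ℝ) - 1 < α) : 0 < Ring.choose α n := by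
  induction n with
  | zero => simp
  | succ n ih =>
    push_cast at h
    have h1 := choose_succ_mul α n
    have h2 := ih (by linarith)
    have h3 : 0 < (α - n) * Ring.choose α n := mul_pos (by linarith) h2
    rw [← h1] at h3
    exact pos_of_mul_pos_right h3 (by positivity)

theorem one_add_mul_fourier_ne_zero {x : ℝ} (hx0 : 0 ≤ x) (hx1 : x < 1) (t : UnitAddCircle) :
    (1 + x * fourier 1 t : ℂ) ≠ 0 := by
  intro h
  have h1 : ‖(x * fourier 1 t : ℂ)‖ = 1 := by
    rw [eq_neg_of_add_eq_zero_right h]; simp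
  rw [norm_mul, norm_fourier_apply, Complex.norm_real, Real.norm_of_nonneg hx0] at h1
  linarith

/-- The recurrence `choose_succ_eq` turns the Parseval coefficients into squares, which makes the
absence of negative terms visible. -/
theorem hasSum_circleFactor_of_lt_one (p : ℝ) {ρ : ℝ} (h0 : 0 < ρ) (h1 : ρ < 1) :
    HasSum (fun n : ℕ => p / 2 / (n + 1) * Ring.choose (p / 2 - 1) n ^ 2 * ρ ^ (2 * n))
      (circleFactor p ρ 1) := by
  have h := (hasSum_integral_binomial (p / 2) (p / 2 - 1) h0.le h1 1).div_const ρ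
  have hv : circleMean p ρ (1 : ℝ) = ∫ t : UnitAddCircle, conj (fourier ((1 : ℕ) : ℤ) t) *
      (1 + ρ * fourier 1 t) ^ ((p / 2 : ℝ) : ℂ) *
        conj ((1 + ρ * fourier 1 t) ^ ((p / 2 - 1 : ℝ) : ℂ)) ∂haarAddCircle := by
    unfold circleMean
    congr 1; ext t
    rw [mul_assoc, ← powerMap_eq_cpow p (one_add_mul_fourier_ne_zero h0.le h1 t), mul_comm,
      mul_comm (fourier 1 t) (ρ : ℂ), add_comm, Nat.cast_one, Complex.ofReal_one]
  unfold circleFactor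
  rw [hv]
  refine h.congr_fun fun n => ?_
  have h2 := choose_succ_eq (p / 2) n
  have h3 : ((n : ℝ) + 1) ≠ 0 := by positivity
  have h4 : Ring.choose (p / 2) (n + 1) = p / 2 * Ring.choose (p / 2 - 1) n / (n + 1) := by
    rw [← h2]; field_simp
  rw [h4, pow_succ]
  field_simp
  ring

theorem hasSum_circleFactor_of_one_lt (p : ℝ) {ρ : ℝ} (h1 : 1 < ρ) :
    HasSum (fun n : ℕ => Ring.choose (p / 2) n * Ring.choose (p / 2 - 1) n * ρ ^ (p - 2 - 2 * n))
      (circleFactor p ρ 1) := by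
  have h0 : 0 < ρ := by linarith
  have h := (hasSum_integral_binomial (p / 2) (p / 2 - 1) (inv_pos.mpr h0).le
    (inv_lt_one_of_one_lt₀ h1) 0).mul_left (ρ ^ (p - 2))
  have hv : circleMean p ρ (1 : ℝ) = ((ρ ^ (p - 2) * ρ : ℝ) : ℂ) *
      conj (∫ t : UnitAddCircle, conj (fourier ((0 : ℕ) : ℤ) t) *
        (1 + (ρ⁻¹ : ℝ) * fourier 1 t) ^ ((p / 2 : ℝ) : ℂ) *
        conj ((1 + (ρ⁻¹ : ℝ) * fourier 1 t) ^ ((p / 2 - 1 : ℝ) : ℂ)) ∂haarAddCircle) := by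
    unfold circleMean
    rw [← integral_conj, ← integral_const_mul]
    congr 1; ext t
    rw [mul_assoc (conj _), ← powerMap_eq_cpow p (one_add_mul_fourier_ne_zero (inv_pos.mpr h0).le
      (inv_lt_one_of_one_lt₀ h1) t)]
    have h2 : fourier 1 t * conj (fourier 1 t) = (1 : ℂ) := by
      rw [Complex.mul_conj, Complex.normSq_eq_norm_sq, norm_fourier_apply]; simp
    -- Since `conj ζ = ζ⁻¹`, extracting `ζρ` leaves `1 + ρ⁻¹ conj ζ`, for which the binomial series
    -- converges.
    have h3 : fourier 1 t * (ρ : ℂ) + (1 : ℝ) =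
        fourier 1 t * (ρ * conj (1 + (ρ⁻¹ : ℝ) * fourier 1 t)) := by
      have : (ρ : ℂ) ≠ 0 := by exact_mod_cast h0.ne'
      simp only [map_add, map_one, map_mul, Complex.conj_ofReal]
      push_cast
      field_simp
      linear_combination -h2
    rw [h3, powerMap_mul_of_norm_one p (norm_fourier_apply 1 t), powerMap_real_mul p h0,
      powerMap_conj]
    simp only [Nat.cast_zero, fourier_zero, map_one, one_mul]
    linear_combination (((ρ ^ (p - 2) * ρ : ℝ) : ℂ) *
      conj (powerMap p (1 + (ρ⁻¹ : ℝ) * fourier 1 t))) * h2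
  unfold circleFactor
  rw [hv, Complex.re_ofReal_mul, Complex.conj_re, mul_assoc, mul_div_assoc, mul_div_cancel_left₀ _ h0.ne']
  refine h.congr_fun fun n => ?_
  rw [Real.rpow_sub h0, show (2 * (n : ℝ)) = ((2 * n : ℕ) : ℝ) by push_cast; ring,
    Real.rpow_natCast]
  simp only [add_zero, inv_pow]
  field_simp

theorem circleFactor_lt_of_lt_one {p : ℝ} (hp : 2 < p) {ρ ρ' : ℝ} (h0 : 0 < ρ) (h : ρ < ρ')
    (h1 : ρ' < 1) : circleFactor p ρ 1 < circleFactor p ρ' 1 := by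
  have hle : ∀ n : ℕ, p / 2 / (n + 1) * Ring.choose (p / 2 - 1) n ^ 2 * ρ ^ (2 * n) ≤
      p / 2 / (n + 1) * Ring.choose (p / 2 - 1) n ^ 2 * ρ' ^ (2 * n) := fun n => by
    have : 0 ≤ p / 2 / ((n : ℝ) + 1) * Ring.choose (p / 2 - 1) n ^ 2 := by positivity
    gcongr
  -- The term `n = 0` is constant in `ρ`; strictness comes from `n = 1`, whose coefficient is
  -- nonzero because `p > 2`.
  refine hasSum_lt hle (i := 1) ?_ (hasSum_circleFactor_of_lt_one p h0 (h.trans h1))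
    (hasSum_circleFactor_of_lt_one p (h0.trans h) h1)
  have h2 : 0 < Ring.choose (p / 2 - 1) 1 := choose_pos (by push_cast; linarith)
  have : 0 < p / 2 / (((1 : ℕ) : ℝ) + 1) * Ring.choose (p / 2 - 1) 1 ^ 2 := by positivity
  gcongr

/-- For `0 < t < 1` and `κ ≤ t (t + 1)` the function `ρ ^ (2 t) + κ ρ ^ (2 t - 2)` is strictly
increasing on `[1, ∞)`. -/
theorem strictMonoOn_rpow_add_rpow {t κ : ℝ} (ht0 : 0 < t) (ht1 : t < 1) (hκ : κ ≤ t * (t + 1)) :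
    StrictMonoOn (fun ρ : ℝ => ρ ^ (2 * t) + κ * ρ ^ (2 * t - 2)) (Set.Ici 1) := by
  have hd : ∀ ρ : ℝ, 1 ≤ ρ → HasDerivAt (fun ρ : ℝ => ρ ^ (2 * t) + κ * ρ ^ (2 * t - 2))
      (2 * t * ρ ^ (2 * t - 1) + κ * ((2 * t - 2) * ρ ^ (2 * t - 2 - 1))) ρ := fun ρ hρ =>
    (Real.hasDerivAt_rpow_const (Or.inl (by linarith))).add
      ((Real.hasDerivAt_rpow_const (Or.inl (by linarith))).const_mul κ)
  refine strictMonoOn_of_deriv_pos (convex_Ici 1)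
    (fun ρ hρ => (hd ρ hρ).continuousAt.continuousWithinAt) fun ρ hρ => ?_
  rw [interior_Ici] at hρ
  have hρ1 : 1 < ρ := hρ
  have h0 : 0 < ρ := by linarith
  rw [(hd ρ hρ1.le).deriv, show 2 * t - 1 = (2 * t - 2 - 1) + (2 : ℕ) by push_cast; ring,
    Real.rpow_add h0, Real.rpow_natCast]
  have hpos : 0 < ρ ^ (2 * t - 2 - 1) := Real.rpow_pos_of_pos h0 _
  have h2 : 0 < 2 * t * ρ ^ 2 + κ * (2 * t - 2) := by
    have h3 : κ * (2 - 2 * t) ≤ t * (t + 1) * (2 - 2 * t) :=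
      mul_le_mul_of_nonneg_right hκ (by linarith)
    have h4 : 2 * t * 1 ≤ 2 * t * ρ ^ 2 := by
      have : 1 ≤ ρ ^ 2 := by nlinarith
      gcongr
    -- The bounds combine to `2t - 2t(t + 1)(1 - t) = 2t³ > 0`.
    have h5 : 0 < t ^ 3 := by positivity
    nlinarith
  have : 2 * t * (ρ ^ (2 * t - 2 - 1) * ρ ^ 2) + κ * ((2 * t - 2) * ρ ^ (2 * t - 2 - 1)) =
      (2 * t * ρ ^ 2 + κ * (2 * t - 2)) * ρ ^ (2 * t - 2 - 1) := by ring
  rw [this]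
  positivity

/-- With `m + 1 = ⌊p/2⌋`, terms `n ≤ m` have positive coefficient and nonnegative exponent, and
terms `n ≥ m + 2` have nonpositive coefficient and negative exponent; none of them decreases. Only
`n = m + 1` can decrease, and it is grouped with `n = m`. -/
theorem circleFactor_lt_of_one_lt {p : ℝ} (hp : 2 < p) {ρ ρ' : ℝ} (h1 : 1 < ρ) (h : ρ < ρ') :
    circleFactor p ρ 1 < circleFactor p ρ' 1 := by
  have hρ0 : 0 < ρ := by linarith
  set q := p / 2 with hq
  have hq1 : 1 < q := by linarith
  set A : ℕ → ℝ := fun n => Ring.choose q n * Ring.choose (q - 1) n with hA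
  set D : ℕ → ℝ := fun n => A n * ρ' ^ (p - 2 - 2 * n) - A n * ρ ^ (p - 2 - 2 * n) with hD
  have hsum : HasSum D (circleFactor p ρ' 1 - circleFactor p ρ 1) :=
    (hasSum_circleFactor_of_one_lt p (h1.trans h)).sub (hasSum_circleFactor_of_one_lt p h1)
  obtain ⟨m, hm⟩ : ∃ m : ℕ, ⌊q⌋₊ = m + 1 :=
    Nat.exists_eq_succ_of_ne_zero (Nat.floor_pos.mpr hq1.le).ne'
  have hm1 : (m : ℝ) + 1 ≤ q := by
    have := Nat.floor_le (show 0 ≤ q by linarith)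
    rw [hm] at this; exact_mod_cast this
  have hm2 : q < (m : ℝ) + 2 := by
    have := Nat.lt_floor_add_one q
    rw [hm] at this; push_cast at this; linarith
  have hlow : ∀ n : ℕ, n ≤ m → 0 < A n := fun n hn => by
    have : (n : ℝ) ≤ m := by exact_mod_cast hn
    exact mul_pos (choose_pos (by linarith)) (choose_pos (by linarith))
  have hDlow : ∀ n : ℕ, n ≤ m → 0 ≤ D n := fun n hn => by
    have h2 : (n : ℝ) ≤ m := by exact_mod_cast hn
    have h3 := hlow n hn
    refine sub_nonneg.mpr (mul_le_mul_of_nonneg_left ?_ h3.le)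
    exact Real.rpow_le_rpow hρ0.le h.le (by linarith)
  have hDhigh : ∀ n : ℕ, m + 2 ≤ n → 0 ≤ D n := fun n hn => by
    obtain ⟨k, rfl⟩ : ∃ k, n = k + 1 := ⟨n - 1, by omega⟩
    have h2 : (m : ℝ) + 2 ≤ k + 1 := by exact_mod_cast hn
    have hAn : A (k + 1) ≤ 0 := by
      have e1 := choose_succ_eq q k
      have e2 := choose_succ_mul (q - 1) k
      have e3 : ((k : ℝ) + 1) ^ 2 * A (k + 1) =
          q * (q - 1 - k) * Ring.choose (q - 1) k ^ 2 := by
        simp only [hA]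
        linear_combination ((k : ℝ) + 1) * Ring.choose (q - 1) (k + 1) * e1 +
          q * Ring.choose (q - 1) k * e2
      have e4 : ((k : ℝ) + 1) ^ 2 * A (k + 1) ≤ 0 := by
        rw [e3]
        refine mul_nonpos_of_nonpos_of_nonneg ?_ (sq_nonneg _)
        exact mul_nonpos_of_nonneg_of_nonpos (by linarith) (by linarith)
      by_contra! hc
      have : 0 < ((k : ℝ) + 1) ^ 2 * A (k + 1) := by positivity
      linarith
    refine sub_nonneg.mpr (mul_le_mul_of_nonpos_left ?_ hAn)
    refine Real.rpow_le_rpow_of_nonpos hρ0 h.le ?_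
    push_cast
    linarith
  -- `t` is the fractional part of `q`; the terms `n = m` and `n = m + 1` have exponents `2t` and
  -- `2t - 2`.
  set t := q - (m + 1) with ht
  have hAm : A (m + 1) = t * (t + 1) / ((m : ℝ) + 1) ^ 2 * A m := by
    have e1 := choose_succ_mul q m
    have e2 := choose_succ_mul (q - 1) m
    have h3 : ((m : ℝ) + 1) ≠ 0 := by positivity
    rw [div_mul_eq_mul_div, eq_div_iff (by positivity)]
    simp only [hA]
    rw [show t * (t + 1) = (q - m) * (q - 1 - m) by rw [ht]; ring]
    linear_combination ((m : ℝ) + 1) * Ring.choose (q - 1) (m + 1) * e1 +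
      (q - m) * Ring.choose q m * e2
  have hfin : 0 < ∑ n ∈ Finset.range (m + 2), D n := by
    rw [Finset.sum_range_succ, Finset.sum_range_succ, add_assoc]
    have hs : 0 ≤ ∑ n ∈ Finset.range m, D n :=
      Finset.sum_nonneg fun n hn => hDlow n (Finset.mem_range.mp hn).le
    -- For integer `q` the exceptional term vanishes and the term `n = m` is constant, so strictness
    -- must come from `n = 0`; there `m > 0` because `q > 1`.
    rcases (show 0 ≤ t by linarith).eq_or_lt with ht0 | ht0
    · have hAm0 : A (m + 1) = 0 := by rw [hAm, ← ht0]; simp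
      have h2 : D (m + 1) = 0 := by simp only [hD, hAm0]; simp
      rw [h2, add_zero]
      have hm0 : 0 < m := by
        rcases Nat.eq_zero_or_pos m with h0 | h0
        · rw [h0] at ht; norm_num at ht; linarith
        · exact h0
      refine add_pos_of_pos_of_nonneg ?_ (hDlow m le_rfl)
      refine Finset.sum_pos' (fun n hn => hDlow n (Finset.mem_range.mp hn).le)
        ⟨0, Finset.mem_range.mpr hm0, ?_⟩
      refine sub_pos.mpr (mul_lt_mul_of_pos_left ?_ (hlow 0 (Nat.zero_le _)))
      refine Real.rpow_lt_rpow hρ0.le h ?_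
      push_cast; linarith
    · refine add_pos_of_nonneg_of_pos hs ?_
      have hκ : t * (t + 1) / ((m : ℝ) + 1) ^ 2 ≤ t * (t + 1) := by
        refine div_le_self (by positivity) ?_
        have : (0 : ℝ) ≤ m := Nat.cast_nonneg m
        nlinarith
      have h2 := strictMonoOn_rpow_add_rpow ht0 (by linarith) hκ h1.le (h1.trans h).le h
      have e1 : p - 2 - 2 * (m : ℝ) = 2 * t := by rw [ht, hq]; ring
      have e2 : p - 2 - 2 * ((m + 1 : ℕ) : ℝ) = 2 * t - 2 := by rw [ht, hq]; push_cast; ring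
      simp only [hD, e1, e2]
      rw [hAm]
      have h3 := mul_lt_mul_of_pos_left h2 (hlow m le_rfl)
      simp only at h3
      linarith
  have := sum_le_hasSum (Finset.range (m + 2)) (fun n hn => hDhigh n (by simpa using hn)) hsum
  linarith

theorem continuousOn_circleFactor {p : ℝ} (hp : 2 < p) (R : ℝ) :
    ContinuousOn (fun ρ => circleFactor p ρ R) (Set.Ioi 0) := by
  unfold circleFactor
  refine ContinuousOn.div ?_ continuousOn_id fun ρ hρ => ne_of_gt hρ
  exact (Complex.continuous_re.comp ((continuous_circleMean hp).comp
    (by fun_prop : Continuous fun ρ : ℝ => ((ρ : ℂ), (R : ℂ))))).continuousOn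

theorem circleFactor_one_lt {p : ℝ} (hp : 2 < p) {ρ ρ' : ℝ} (h0 : 0 < ρ) (h : ρ < ρ') :
    circleFactor p ρ 1 < circleFactor p ρ' 1 := by
  have hc : ContinuousAt (fun ρ => circleFactor p ρ 1) 1 :=
    (continuousOn_circleFactor hp 1).continuousAt (Ioi_mem_nhds one_pos)
  have hleft : ∀ x : ℝ, 0 < x → x < 1 → circleFactor p x 1 < circleFactor p 1 1 := by
    intro x hx0 hx1
    -- Stopping at the midpoint secures a strict inequality before the limit at `1`, which only
    -- preserves `≤`.
    have hm : x < (x + 1) / 2 := by linarith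
    have hm1 : (x + 1) / 2 < 1 := by linarith
    refine (circleFactor_lt_of_lt_one hp hx0 hm hm1).trans_le ?_
    refine ge_of_tendsto (hc.tendsto.mono_left (nhdsWithin_le_nhds (s := Set.Iio 1))) ?_
    filter_upwards [Ioo_mem_nhdsLT hm1] with y hy
    exact (circleFactor_lt_of_lt_one hp (by linarith) hy.1 hy.2).le
  have hright : ∀ x : ℝ, 1 < x → circleFactor p 1 1 < circleFactor p x 1 := by
    intro x hx1
    have hm : (x + 1) / 2 < x := by linarith
    have hm1 : 1 < (x + 1) / 2 := by linarith
    refine lt_of_le_of_lt ?_ (circleFactor_lt_of_one_lt hp hm1 hm)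
    refine le_of_tendsto (hc.tendsto.mono_left (nhdsWithin_le_nhds (s := Set.Ioi 1))) ?_
    filter_upwards [Ioo_mem_nhdsGT hm1] with y hy
    exact (circleFactor_lt_of_one_lt hp hy.1 hy.2).le
  rcases lt_trichotomy ρ' 1 with h1 | h1 | h1
  · exact circleFactor_lt_of_lt_one hp h0 h h1
  · subst h1; exact hleft ρ h0 h
  · rcases lt_trichotomy ρ 1 with h2 | h2 | h2
    · exact (hleft ρ h0 h2).trans (hright ρ' h1)
    · subst h2; exact hright ρ' h1
    · exact circleFactor_lt_of_one_lt hp h2 h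

theorem circleFactor_scale (p : ℝ) {ρ R : ℝ} (hR : 0 < R) :
    circleFactor p ρ R = R ^ (p - 2) * circleFactor p (ρ / R) 1 := by
  have : circleMean p ρ R = ((R ^ (p - 2) * R : ℝ) : ℂ) * circleMean p (ρ / R : ℝ) (1 : ℝ) := by
    unfold circleMean
    rw [← integral_const_mul]
    congr 1; ext t
    rw [← mul_assoc, ← powerMap_real_mul p hR]
    congr 2
    have : (R : ℂ) ≠ 0 := by exact_mod_cast hR.ne'
    push_cast
    field_simp
  unfold circleFactor
  rw [this, Complex.re_ofReal_mul]
  rcases eq_or_ne ρ 0 with rfl | h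
  · simp
  · field_simp

theorem circleFactor_zero_right (p : ℝ) {ρ : ℝ} (h0 : 0 < ρ) :
    circleFactor p ρ 0 = ρ ^ (p - 2) := by
  have : circleMean p ρ (0 : ℝ) = ((ρ ^ (p - 2) * ρ : ℝ) : ℂ) := by
    unfold circleMean
    have : ∀ t : UnitAddCircle, powerMap p (fourier 1 t * ρ + (0 : ℝ)) * conj (fourier 1 t) =
        ((ρ ^ (p - 2) * ρ : ℝ) : ℂ) := by
      intro t
      have h2 : fourier 1 t * conj (fourier 1 t) = (1 : ℂ) := by
        rw [Complex.mul_conj, Complex.normSq_eq_norm_sq, norm_fourier_apply]; simp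
      have h3 : powerMap p (1 : ℂ) = 1 := by simp [powerMap]
      rw [Complex.ofReal_zero, add_zero, powerMap_mul_of_norm_one p (norm_fourier_apply 1 t),
        mul_right_comm, h2, one_mul]
      simpa [h3] using powerMap_real_mul p h0 1
    simp_rw [this]
    simp
  unfold circleFactor
  rw [this, Complex.ofReal_re, mul_div_cancel_right₀ _ h0.ne']

/-- `circleFactor` is strictly increasing in the first variable. -/
theorem circleFactor_lt {p : ℝ} (hp : 2 < p) {ρ ρ' R : ℝ} (hR : 0 ≤ R) (h0 : 0 < ρ)
    (h : ρ < ρ') : circleFactor p ρ R < circleFactor p ρ' R := by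
  rcases hR.eq_or_lt with rfl | hR
  · rw [circleFactor_zero_right p h0, circleFactor_zero_right p (h0.trans h)]
    exact Real.rpow_lt_rpow h0.le h (by linarith)
  · rw [circleFactor_scale p hR, circleFactor_scale p hR]
    refine mul_lt_mul_of_pos_left ?_ (Real.rpow_pos_of_pos hR _)
    exact circleFactor_one_lt hp (by positivity) (by gcongr)

/-! ### Phase symmetries of the circle mean -/

theorem integral_circle_add_right {f : UnitAddCircle → ℂ} (s : UnitAddCircle) :
    ∫ t, f (t + s) ∂haarAddCircle = ∫ t, f t ∂haarAddCircle :=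
  integral_add_right_eq_self f s

theorem circleMean_mul_left (p : ℝ) (s : UnitAddCircle) (u w : ℂ) :
    circleMean p (fourier 1 s * u) w = fourier 1 s * circleMean p u w := by
  have h1 : fourier 1 s * conj (fourier 1 s) = (1 : ℂ) := by
    rw [Complex.mul_conj, Complex.normSq_eq_norm_sq, norm_fourier_apply]; simp
  unfold circleMean
  conv_rhs => rw [← integral_circle_add_right s, ← integral_const_mul]
  congr 1; ext t
  have h2 : (fourier 1 (t + s) : ℂ) = fourier 1 t * fourier 1 s := by
    simp [AddCircle.toCircle_add]
  rw [h2, map_mul, mul_assoc (fourier 1 t)]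
  linear_combination (-(powerMap p (fourier 1 t * (fourier 1 s * u) + w) * conj (fourier 1 t))) * h1

theorem circleMean_mul_right (p : ℝ) (s : UnitAddCircle) (u w : ℂ) :
    circleMean p u (fourier 1 s * w) = circleMean p u w := by
  have h1 : fourier 1 s * conj (fourier 1 s) = (1 : ℂ) := by
    rw [Complex.mul_conj, Complex.normSq_eq_norm_sq, norm_fourier_apply]; simp
  unfold circleMean
  rw [← integral_circle_add_right s]
  congr 1; ext t
  have h2 : (fourier 1 (t + s) : ℂ) = fourier 1 t * fourier 1 s := by
    simp [AddCircle.toCircle_add]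
  rw [h2, map_mul, show fourier 1 t * fourier 1 s * u + fourier 1 s * w =
    fourier 1 s * (fourier 1 t * u + w) by ring,
    powerMap_mul_of_norm_one p (norm_fourier_apply 1 s)]
  linear_combination (powerMap p (fourier 1 t * u + w) * conj (fourier 1 t)) * h1

theorem circleMean_conj (p : ℝ) (u w : ℂ) :
    circleMean p (conj u) (conj w) = conj (circleMean p u w) := by
  unfold circleMean
  rw [← integral_conj, ← integral_neg_eq_self]
  congr 1; ext t
  have h : (fourier 1 (-t) : ℂ) = conj (fourier 1 t) := by
    rw [← fourier_neg]; simp [fourier_apply]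
  rw [h, map_mul, ← powerMap_conj]
  simp

theorem exists_fourier_mul_norm (u : ℂ) : ∃ s : UnitAddCircle, u = fourier 1 s * (‖u‖ : ℂ) := by
  refine ⟨((u.arg / (2 * Real.pi) : ℝ) : AddCircle (1 : ℝ)), ?_⟩
  rw [fourier_coe_apply]
  conv_lhs => rw [← Complex.norm_mul_exp_arg_mul_I u]
  rw [mul_comm]
  congr 2
  have : (Real.pi : ℂ) ≠ 0 := by exact_mod_cast Real.pi_ne_zero
  push_cast
  field_simp

/-- Rotations of `u` and `w` reduce to nonnegative real arguments, where conjugation symmetry makes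
the mean real. -/
theorem circleMean_eq (p : ℝ) (u w : ℂ) :
    circleMean p u w = u * (circleFactor p ‖u‖ ‖w‖ : ℂ) := by
  obtain ⟨s, hs⟩ := exists_fourier_mul_norm u
  obtain ⟨s', hs'⟩ := exists_fourier_mul_norm w
  have him : circleMean p ‖u‖ ‖w‖ = ((circleMean p ‖u‖ ‖w‖).re : ℂ) := by
    rw [eq_comm, ← Complex.conj_eq_iff_re, ← circleMean_conj, Complex.conj_ofReal,
      Complex.conj_ofReal]
  conv_lhs => rw [hs, hs', circleMean_mul_left, circleMean_mul_right, him]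
  conv_rhs => lhs; rw [hs]
  -- At `u = 0` the factor is a division by zero, so the mean must vanish by itself: a half turn of
  -- `u` changes its sign.
  rcases eq_or_ne ‖u‖ 0 with h | h
  · have : circleMean p 0 ‖w‖ = 0 := by
      have hu := circleMean_mul_left p ((1 / 2 : ℝ) : AddCircle (1 : ℝ)) 0 ‖w‖
      rw [mul_zero, fourier_coe_apply] at hu
      have : Complex.exp (2 * Real.pi * Complex.I * (1 : ℤ) * ((1 / 2 : ℝ) : ℂ) / (1 : ℝ)) = -1 := by
        rw [← Complex.exp_pi_mul_I]; congr 1; push_cast; ring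
      rw [this] at hu
      linear_combination hu / 2
    rw [h, Complex.ofReal_zero, this]
    simp
  · unfold circleFactor
    have : (‖u‖ : ℂ) ≠ 0 := by exact_mod_cast h
    push_cast
    field_simp

theorem circleFactor_pos {p : ℝ} (hp : 2 < p) {ρ R : ℝ} (hρ : 0 < ρ) (hR : 0 ≤ R) :
    0 < circleFactor p ρ R := by
  rcases hR.eq_or_lt with rfl | hR
  · rw [circleFactor_zero_right p hρ]
    exact Real.rpow_pos_of_pos hρ _
  · have hr0 : 0 < min ρ R / 2 := by positivity
    have hr1 : min ρ R / 2 < ρ := by linarith [min_le_left ρ R]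
    have hr2 : min ρ R / 2 / R < 1 := by rw [div_lt_one hR]; linarith [min_le_right ρ R]
    refine lt_of_le_of_lt ?_ (circleFactor_lt hp hR.le hr0 hr1)
    rw [circleFactor_scale p hR]
    refine mul_nonneg (by positivity)
      ((hasSum_circleFactor_of_lt_one p (by positivity) hr2).nonneg fun n => ?_)
    positivity

/-! ### Linear forms on the torus and averaging over phases -/

variable {d : ℕ}

/-- The value of the polynomial `∑ i ∈ S, c i z_i` at a point of the torus. -/
def linearForm (S : Finset (Fin d)) (c : Fin d → ℂ) (x : Torus d) : ℂ :=
  ∑ i ∈ S, c i * fourier 1 (x i)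

@[fun_prop]
theorem continuous_linearForm (S : Finset (Fin d)) (c : Fin d → ℂ) :
    Continuous (linearForm S c) := by
  unfold linearForm
  fun_prop

/-- The point of the torus with entries `t` on `S` and `0` off `S`. -/
def shift (S : Finset (Fin d)) (t : UnitAddCircle) : Torus d := fun i => if i ∈ S then t else 0

theorem continuous_shift (S : Finset (Fin d)) : Continuous (shift S) := by
  refine continuous_pi fun i => ?_
  unfold shift
  split_ifs <;> fun_prop

theorem fourier_add_shift {S : Finset (Fin d)} {i : Fin d} (hi : i ∈ S) (x : Torus d)
    (t : UnitAddCircle) : (fourier 1 ((x + shift S t) i) : ℂ) = fourier 1 t * fourier 1 (x i) := by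
  simp [shift, hi, AddCircle.toCircle_add, mul_comm]

theorem fourier_add_shift_of_notMem {S : Finset (Fin d)} {i : Fin d} (hi : i ∉ S) (x : Torus d)
    (t : UnitAddCircle) : (fourier 1 ((x + shift S t) i) : ℂ) = fourier 1 (x i) := by
  simp [shift, hi]

theorem linearForm_add_shift (S : Finset (Fin d)) (c : Fin d → ℂ) (x : Torus d)
    (t : UnitAddCircle) : linearForm S c (x + shift S t) = fourier 1 t * linearForm S c x := by
  unfold linearForm
  rw [Finset.mul_sum]
  refine Finset.sum_congr rfl fun i hi => ?_
  rw [fourier_add_shift hi]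
  ring

theorem linearForm_add_shift_of_disjoint {S S' : Finset (Fin d)} (h : Disjoint S S')
    (c : Fin d → ℂ) (x : Torus d) (t : UnitAddCircle) :
    linearForm S c (x + shift S' t) = linearForm S c x := by
  unfold linearForm
  refine Finset.sum_congr rfl fun i hi => ?_
  rw [fourier_add_shift_of_notMem (Finset.disjoint_left.mp h hi)]

theorem linearForm_univ (S : Finset (Fin d)) (c : Fin d → ℂ) (x : Torus d) :
    linearForm Finset.univ c x = linearForm S c x + linearForm Sᶜ c x :=
  (Finset.sum_add_sum_compl S _).symm

theorem integrable_torus {E : Type*} [NormedAddCommGroup E] {f : Torus d → E}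
    (hf : Continuous f) : Integrable f (haarTorus d) :=
  hf.integrable_of_hasCompactSupport (HasCompactSupport.of_compactSpace _)

theorem integral_torus_add {E : Type*} [NormedAddCommGroup E] [NormedSpace ℝ E]
    (f : Torus d → E) (v : Torus d) :
    ∫ x, f (x + v) ∂haarTorus d = ∫ x, f x ∂haarTorus d := by
  simp_rw [add_comm _ v]
  exact integral_add_left_eq_self f v

theorem integral_torus_eq_integral_shift {f : Torus d → ℂ} (hf : Continuous f)
    (S : Finset (Fin d)) :
    ∫ x, f x ∂haarTorus d = ∫ x, ∫ t, f (x + shift S t) ∂haarAddCircle ∂haarTorus d := by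
  rw [integral_integral_swap]
  · simp_rw [integral_torus_add]
    simp
  · have := continuous_shift S
    exact Continuous.integrable_of_hasCompactSupport
      (by simp only [Function.uncurry_def]; fun_prop) (HasCompactSupport.of_compactSpace _)

/-- Averaging over the common phase of the variables in `S`. -/
theorem integral_powerMap_linearForm_mul {p : ℝ} (hp : 2 < p) (S : Finset (Fin d))
    (c : Fin d → ℂ) {ψ : Torus d → ℂ} (hψ : Continuous ψ)
    (hS : ∀ x t, ψ (x + shift S t) = conj (fourier 1 t) * ψ x) :
    ∫ x, powerMap p (linearForm Finset.univ c x) * ψ x ∂haarTorus d =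
      ∫ x, (circleFactor p ‖linearForm S c x‖ ‖linearForm Sᶜ c x‖ : ℂ) *
        (linearForm S c x * ψ x) ∂haarTorus d := by
  have hg := continuous_powerMap hp
  rw [integral_torus_eq_integral_shift (by fun_prop) S]
  congr 1; ext x
  have := circleMean_eq p (linearForm S c x) (linearForm Sᶜ c x)
  have h2 : ∫ t, powerMap p (linearForm Finset.univ c (x + shift S t)) * ψ (x + shift S t)
      ∂haarAddCircle = circleMean p (linearForm S c x) (linearForm Sᶜ c x) * ψ x := by
    unfold circleMean
    rw [← integral_mul_const]
    congr 1; ext t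
    rw [linearForm_univ S, linearForm_add_shift,
      linearForm_add_shift_of_disjoint disjoint_compl_left, hS]
    ring
  rw [h2, this]
  ring

/-! ### Growth factors and their comparison -/

/-- The `j`-th coefficient of the Riesz projection of `|φ|^{p-2} φ` for `φ = ∑ c_i z_i`. -/
def projCoeff (p : ℝ) (c : Fin d → ℂ) (j : Fin d) : ℂ :=
  ∫ x, powerMap p (linearForm Finset.univ c x) * conj (fourier 1 (x j)) ∂haarTorus d

/-- The factor by which the `j`-th coefficient changes. -/
def growthFactor (p : ℝ) (c : Fin d → ℂ) (j : Fin d) : ℝ :=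
  ∫ x, circleFactor p ‖c j‖ ‖linearForm {j}ᶜ c x‖ ∂haarTorus d

theorem fourier_mul_conj (t : UnitAddCircle) : fourier 1 t * conj (fourier 1 t) = (1 : ℂ) := by
  rw [Complex.mul_conj, Complex.normSq_eq_norm_sq, norm_fourier_apply]; simp

theorem projCoeff_eq {p : ℝ} (hp : 2 < p) (c : Fin d → ℂ) (j : Fin d) :
    projCoeff p c j = c j * growthFactor p c j := by
  have hcast : (growthFactor p c j : ℂ) =
      ∫ x, (circleFactor p ‖c j‖ ‖linearForm {j}ᶜ c x‖ : ℂ) ∂haarTorus d :=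
    (integral_ofReal (𝕜 := ℂ)).symm
  unfold projCoeff
  rw [integral_powerMap_linearForm_mul hp {j} c (ψ := fun x => conj (fourier 1 (x j)))
    (by fun_prop), hcast, ← integral_const_mul]
  · congr 1; ext x
    have h1 : linearForm {j} c x = c j * fourier 1 (x j) := by simp [linearForm]
    rw [h1, norm_mul, norm_fourier_apply, mul_one, mul_assoc (c j), fourier_mul_conj]
    ring
  · intro x t
    rw [fourier_add_shift (Finset.mem_singleton_self j), map_mul]

theorem continuous_circleFactor_comp {p : ℝ} (hp : 2 < p) {u w : Torus d → ℂ} (hu : Continuous u)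
    (hw : Continuous w) (h0 : ∀ x, u x ≠ 0) :
    Continuous fun x => circleFactor p ‖u x‖ ‖w x‖ := by
  unfold circleFactor
  refine Continuous.div ?_ hu.norm fun x => norm_ne_zero_iff.mpr (h0 x)
  exact Complex.continuous_re.comp (continuous_circleMean_comp hp
    (Complex.continuous_ofReal.comp hu.norm) (Complex.continuous_ofReal.comp hw.norm))

theorem integral_torus_pos {f : Torus d → ℝ} (hf : Continuous f) (h0 : ∀ x, 0 ≤ f x)
    {x : Torus d} (hx : f x ≠ 0) : 0 < ∫ x, f x ∂haarTorus d :=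
  hf.integral_pos_of_hasCompactSupport_nonneg_nonzero (HasCompactSupport.of_compactSpace _) h0 hx

theorem growthFactor_pos {p : ℝ} (hp : 2 < p) {c : Fin d → ℂ} {j : Fin d} (hj : c j ≠ 0) :
    0 < growthFactor p c j := by
  have h : ∀ x, 0 < circleFactor p ‖c j‖ ‖linearForm {j}ᶜ c x‖ := fun x =>
    circleFactor_pos hp (norm_pos_iff.mpr hj) (norm_nonneg _)
  exact integral_torus_pos (continuous_circleFactor_comp hp (u := fun _ => c j) continuous_const
    (continuous_linearForm _ c) fun _ => hj) (fun x => (h x).le) (h 0).ne'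

/-- Averaging over the common phase of two variables. -/
theorem re_projCoeff_combination {p : ℝ} (hp : 2 < p) (c : Fin d → ℂ) (j k : Fin d) (a b : ℂ) :
    (projCoeff p c j * a - projCoeff p c k * b).re =
      ∫ x, circleFactor p ‖linearForm {j, k} c x‖ ‖linearForm {j, k}ᶜ c x‖ *
        (linearForm {j, k} c x * (conj (fourier 1 (x j)) * a - conj (fourier 1 (x k)) * b)).re
        ∂haarTorus d := by
  have hg := continuous_powerMap hp
  have h1 : projCoeff p c j * a - projCoeff p c k * b =
      ∫ x, powerMap p (linearForm Finset.univ c x) *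
        (conj (fourier 1 (x j)) * a - conj (fourier 1 (x k)) * b) ∂haarTorus d := by
    unfold projCoeff
    rw [← integral_mul_const, ← integral_mul_const, ← integral_sub]
    · congr 1; ext x; ring
    · exact integrable_torus (by fun_prop)
    · exact integrable_torus (by fun_prop)
  have h2 : ∀ x, (circleFactor p ‖linearForm {j, k} c x‖ ‖linearForm {j, k}ᶜ c x‖ *
        (linearForm {j, k} c x * (conj (fourier 1 (x j)) * a - conj (fourier 1 (x k)) * b)).re) =
      (circleMean p (linearForm {j, k} c x) (linearForm {j, k}ᶜ c x) *
        (conj (fourier 1 (x j)) * a - conj (fourier 1 (x k)) * b)).re := by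
    intro x
    rw [circleMean_eq, ← Complex.re_ofReal_mul]
    congr 1
    ring
  have h3 : Continuous fun x : Torus d =>
      circleMean p (linearForm {j, k} c x) (linearForm {j, k}ᶜ c x) :=
    continuous_circleMean_comp hp (continuous_linearForm _ c) (continuous_linearForm _ c)
  have h4 : ∀ x, (circleFactor p ‖linearForm {j, k} c x‖ ‖linearForm {j, k}ᶜ c x‖ : ℂ) *
        (linearForm {j, k} c x * (conj (fourier 1 (x j)) * a - conj (fourier 1 (x k)) * b)) =
      circleMean p (linearForm {j, k} c x) (linearForm {j, k}ᶜ c x) *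
        (conj (fourier 1 (x j)) * a - conj (fourier 1 (x k)) * b) := by
    intro x
    rw [circleMean_eq]
    ring
  rw [h1, integral_powerMap_linearForm_mul hp {j, k} c
    (ψ := fun x => conj (fourier 1 (x j)) * a - conj (fourier 1 (x k)) * b) (by fun_prop)]
  · simp_rw [h2, h4]
    exact (integral_re (𝕜 := ℂ) (integrable_torus (h3.mul (by fun_prop)))).symm
  · intro x t
    rw [fourier_add_shift (by simp), fourier_add_shift (by simp)]
    simp only [map_mul]
    ring

theorem linearForm_pair {j k : Fin d} (h : j ≠ k) (c : Fin d → ℂ) (x : Torus d) :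
    linearForm {j, k} c x = c j * fourier 1 (x j) + c k * fourier 1 (x k) := by
  simp only [linearForm]
  exact Finset.sum_pair h

/-- Larger coefficients stay larger. -/
theorem norm_mul_growthFactor_le {p : ℝ} (hp : 2 < p) {c : Fin d → ℂ} {j k : Fin d}
    (hj : c j ≠ 0) (hk : c k ≠ 0) (h : ‖c k‖ ≤ ‖c j‖) :
    ‖c k‖ * growthFactor p c k ≤ ‖c j‖ * growthFactor p c j := by
  rcases eq_or_ne j k with rfl | hjk
  · rfl
  have hj' : (‖c j‖ : ℂ) ≠ 0 := by simpa using hj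
  have hk' : (‖c k‖ : ℂ) ≠ 0 := by simpa using hk
  have hcj : c j * conj (c j) = (‖c j‖ : ℂ) ^ 2 := by
    rw [Complex.mul_conj, Complex.normSq_eq_norm_sq]; push_cast; rfl
  have hck : c k * conj (c k) = (‖c k‖ : ℂ) ^ 2 := by
    rw [Complex.mul_conj, Complex.normSq_eq_norm_sq]; push_cast; rfl
  -- These unimodular weights remove the phases, so the left side becomes the difference of the new
  -- moduli before normalization.
  have key := re_projCoeff_combination hp c j k (conj (c j) / ‖c j‖) (conj (c k) / ‖c k‖)
  have hl : projCoeff p c j * (conj (c j) / ‖c j‖) - projCoeff p c k * (conj (c k) / ‖c k‖) =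
      ((‖c j‖ * growthFactor p c j - ‖c k‖ * growthFactor p c k : ℝ) : ℂ) := by
    rw [projCoeff_eq hp, projCoeff_eq hp]
    push_cast
    field_simp
    linear_combination (growthFactor p c j * ‖c k‖ : ℂ) * hcj - (growthFactor p c k * ‖c j‖ : ℂ) * hck
  rw [hl, Complex.ofReal_re] at key
  rw [← sub_nonneg, key]
  refine integral_nonneg fun x => ?_
  have hC : linearForm {j, k} c x * (conj (fourier 1 (x j)) * (conj (c j) / ‖c j‖) -
      conj (fourier 1 (x k)) * (conj (c k) / ‖c k‖)) =
      ((‖c j‖ - ‖c k‖ : ℝ) : ℂ) + (c k * fourier 1 (x k) * conj (c j * fourier 1 (x j))) / ‖c j‖ -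
      conj (c k * fourier 1 (x k) * conj (c j * fourier 1 (x j))) / ‖c k‖ := by
    rw [linearForm_pair hjk]
    simp only [map_mul, Complex.conj_conj]
    have e1 := fourier_mul_conj (x j)
    have e2 := fourier_mul_conj (x k)
    push_cast
    field_simp
    linear_combination (‖c k‖ : ℂ) * hcj * fourier 1 (x j) * conj (fourier 1 (x j)) -
      (‖c j‖ : ℂ) * hck * fourier 1 (x k) * conj (fourier 1 (x k)) +
      (‖c k‖ : ℂ) * (‖c j‖ : ℂ) ^ 2 * e1 - (‖c j‖ : ℂ) * (‖c k‖ : ℂ) ^ 2 * e2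
  set Z := c k * fourier 1 (x k) * conj (c j * fourier 1 (x j)) with hZ
  have hZn : ‖Z‖ = ‖c k‖ * ‖c j‖ := by
    simp only [hZ, norm_mul, RCLike.norm_conj, norm_fourier_apply, mul_one]
  have hre : (linearForm {j, k} c x * (conj (fourier 1 (x j)) * (conj (c j) / ‖c j‖) -
      conj (fourier 1 (x k)) * (conj (c k) / ‖c k‖))).re =
      (‖c j‖ - ‖c k‖) * (1 - Z.re / (‖c j‖ * ‖c k‖)) := by
    rw [hC, Complex.sub_re, Complex.add_re, Complex.ofReal_re, Complex.div_ofReal_re,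
      Complex.div_ofReal_re, Complex.conj_re]
    have : ‖c j‖ ≠ 0 := norm_ne_zero_iff.mpr hj
    have : ‖c k‖ ≠ 0 := norm_ne_zero_iff.mpr hk
    field_simp
    ring
  simp only [Pi.zero_apply]
  rw [hre]
  refine mul_nonneg ?_ (mul_nonneg (sub_nonneg.mpr h) (sub_nonneg.mpr ?_))
  · rcases (norm_nonneg (linearForm {j, k} c x)).eq_or_lt with h0 | h0
    -- Where the linear form vanishes, division by zero gives the factor the value `0`.
    · rw [← h0]; simp [circleFactor]
    · exact (circleFactor_pos hp h0 (norm_nonneg _)).le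
  · refine div_le_one_of_le₀ ?_ (by positivity)
    rw [mul_comm, ← hZn]
    exact Complex.re_le_norm Z

theorem fourier_half : (fourier 1 ((1 / 2 : ℝ) : AddCircle (1 : ℝ)) : ℂ) = -1 := by
  rw [fourier_coe_apply, ← Complex.exp_pi_mul_I]
  congr 1; push_cast; ring

/-- The factor is strictly smaller for the larger coefficient. -/
theorem growthFactor_lt {p : ℝ} (hp : 2 < p) {c : Fin d → ℂ} {j k : Fin d}
    (hk : c k ≠ 0) (h : ‖c k‖ < ‖c j‖) : growthFactor p c j < growthFactor p c k := by
  have hjk : j ≠ k := by rintro rfl; exact lt_irrefl _ h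
  have hk0 : 0 < ‖c k‖ := norm_pos_iff.mpr hk
  have hj0 : 0 < ‖c j‖ := hk0.trans h
  have hj : c j ≠ 0 := norm_pos_iff.mp hj0
  have hj' : (‖c j‖ : ℂ) ≠ 0 := by simpa using hj
  have hk' : (‖c k‖ : ℂ) ≠ 0 := by simpa using hk
  -- Dividing by the coefficients turns the left side into the difference of the growth factors
  -- themselves.
  have key := re_projCoeff_combination hp c j k (c j)⁻¹ (c k)⁻¹
  have hl : projCoeff p c j * (c j)⁻¹ - projCoeff p c k * (c k)⁻¹ =
      ((growthFactor p c j - growthFactor p c k : ℝ) : ℂ) := by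
    rw [projCoeff_eq hp, projCoeff_eq hp]
    push_cast
    field_simp
  rw [hl, Complex.ofReal_re] at key
  set θ : Torus d → ℝ := fun x =>
    (c j * fourier 1 (x j) * conj (c k * fourier 1 (x k))).re with hθ
  set u := linearForm {j, k} c with hu
  set w := linearForm {j, k}ᶜ c with hw
  set N := ‖c j‖ ^ 2 + ‖c k‖ ^ 2 with hN
  have hnorm : ∀ x, ‖u x‖ ^ 2 = N + 2 * θ x := by
    intro x
    rw [hu, linearForm_pair hjk, ← Complex.normSq_eq_norm_sq, Complex.normSq_add,
      Complex.normSq_eq_norm_sq, Complex.normSq_eq_norm_sq, norm_mul, norm_mul,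
      norm_fourier_apply, norm_fourier_apply, mul_one, mul_one]
  have hune : ∀ x, u x ≠ 0 := by
    intro x h0
    rw [hu, linearForm_pair hjk] at h0
    have h1 := congrArg norm (eq_neg_of_add_eq_zero_left h0)
    rw [norm_neg, norm_mul, norm_mul, norm_fourier_apply, norm_fourier_apply, mul_one,
      mul_one] at h1
    exact h.ne' h1
  have hre : ∀ x, (u x * (conj (fourier 1 (x j)) * (c j)⁻¹ - conj (fourier 1 (x k)) * (c k)⁻¹)).re =
      θ x * (1 / ‖c j‖ ^ 2 - 1 / ‖c k‖ ^ 2) := by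
    intro x
    have hinv : ∀ z : ℂ, z⁻¹ = conj z / ((‖z‖ ^ 2 : ℝ) : ℂ) := fun z => by
      rw [Complex.inv_def, Complex.normSq_eq_norm_sq, div_eq_mul_inv, Complex.ofReal_inv]
    set Z := c j * fourier 1 (x j) * conj (c k * fourier 1 (x k)) with hZ
    have e1 := fourier_mul_conj (x j)
    have e2 := fourier_mul_conj (x k)
    have hC : u x * (conj (fourier 1 (x j)) * (c j)⁻¹ - conj (fourier 1 (x k)) * (c k)⁻¹) =
        conj Z / ((‖c j‖ ^ 2 : ℝ) : ℂ) - Z / ((‖c k‖ ^ 2 : ℝ) : ℂ) := by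
      have e3 : c j * (c j)⁻¹ = 1 := mul_inv_cancel₀ hj
      have e4 : c k * (c k)⁻¹ = 1 := mul_inv_cancel₀ hk
      rw [hu, linearForm_pair hjk]
      have e5 : conj Z / ((‖c j‖ ^ 2 : ℝ) : ℂ) =
          c k * fourier 1 (x k) * conj (fourier 1 (x j)) * (c j)⁻¹ := by
        rw [hZ, hinv (c j)]; simp only [map_mul, Complex.conj_conj]; ring
      have e6 : Z / ((‖c k‖ ^ 2 : ℝ) : ℂ) =
          c j * fourier 1 (x j) * conj (fourier 1 (x k)) * (c k)⁻¹ := by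
        rw [hZ, hinv (c k)]; simp only [map_mul]; ring
      rw [e5, e6]
      linear_combination e1 * (c j * (c j)⁻¹) + e3 - e2 * (c k * (c k)⁻¹) - e4
    rw [hC, Complex.sub_re, Complex.div_ofReal_re, Complex.div_ofReal_re, Complex.conj_re]
    ring
  simp_rw [hre, ← mul_assoc] at key
  rw [integral_mul_const] at key
  set G : Torus d → ℝ := fun x => circleFactor p ‖u x‖ ‖w x‖ * θ x with hG
  have hθc : Continuous θ := Complex.continuous_re.comp (by fun_prop)
  have hGc : Continuous G := (continuous_circleFactor_comp hp (continuous_linearForm _ c)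
    (continuous_linearForm _ c) hune).mul hθc
  -- Translation by `v` is `z_j ↦ -z_j`, a measure-preserving involution that pairs points with
  -- opposite `θ` and equal `w`.
  set v : Torus d := shift {j} ((1 / 2 : ℝ) : AddCircle (1 : ℝ)) with hv
  have hθv : ∀ x, θ (x + v) = -θ x := by
    intro x
    have h1 : (fourier 1 ((x + v) j) : ℂ) = -fourier 1 (x j) := by
      rw [hv, fourier_add_shift (Finset.mem_singleton_self j), fourier_half, neg_one_mul]
    have h2 : (fourier 1 ((x + v) k) : ℂ) = fourier 1 (x k) := by
      rw [hv, fourier_add_shift_of_notMem (by simpa using hjk.symm)]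
    simp only [hθ]
    rw [h1, h2, mul_neg, neg_mul, Complex.neg_re]
  have hwv : ∀ x, w (x + v) = w x := fun x =>
    linearForm_add_shift_of_disjoint (by simp) c x _
  have hdiff : ∀ x, θ x ≠ 0 → 0 < G x + G (x + v) := by
    have aux : ∀ x, 0 < θ x → 0 < G x + G (x + v) := by
      intro x hx
      have hlt : ‖u (x + v)‖ < ‖u x‖ := by
        refine lt_of_pow_lt_pow_left₀ 2 (norm_nonneg _) ?_
        rw [hnorm, hnorm, hθv]
        linarith
      have := circleFactor_lt hp (norm_nonneg (w x)) (norm_pos_iff.mpr (hune (x + v))) hlt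
      simp only [hG, hθv, hwv]
      nlinarith
    intro x hx
    rcases hx.lt_or_gt with h0 | h0
    · have h1 := aux (x + v) (by rw [hθv]; linarith)
      have h2 : G (x + v + v) = G x := by
        have h3 : ‖u (x + v + v)‖ = ‖u x‖ := by
          rw [← sq_eq_sq₀ (norm_nonneg _) (norm_nonneg _), hnorm, hnorm, hθv, hθv, neg_neg]
        simp only [hG, hwv, hθv, neg_neg, h3]
      rw [h2] at h1
      linarith
    · exact aux x h0
  have hpos : 0 < ∫ x, (G x + G (x + v)) ∂haarTorus d := by
    -- At this point `c_j z_j` and `c_k z_k` are both positive reals, so `θ > 0`.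
    choose s hs using fun i => exists_fourier_mul_norm (conj (c i))
    refine integral_torus_pos (x := s) (by fun_prop) (fun x => ?_) (hdiff s ?_).ne'
    · by_cases h0 : θ x = 0
      · simp [hG, hθv, h0]
      · exact (hdiff x h0).le
    · have hci : ∀ i, c i * fourier 1 (s i) * (‖c i‖ : ℂ) = (‖c i‖ : ℂ) ^ 2 := by
        intro i
        have := hs i
        rw [RCLike.norm_conj] at this
        rw [mul_assoc, ← this, Complex.mul_conj, Complex.normSq_eq_norm_sq]
        push_cast; rfl
      have h1 : c j * fourier 1 (s j) = ‖c j‖ := by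
        apply mul_right_cancel₀ hj'; rw [hci]; ring
      have h2 : c k * fourier 1 (s k) = ‖c k‖ := by
        apply mul_right_cancel₀ hk'; rw [hci]; ring
      have : θ s = ‖c j‖ * ‖c k‖ := by
        simp only [hθ]
        rw [h1, h2, Complex.conj_ofReal, ← Complex.ofReal_mul, Complex.ofReal_re]
      rw [this]
      positivity
  rw [integral_add (integrable_torus hGc) (integrable_torus (by fun_prop)),
    integral_torus_add] at hpos
  have hneg : 1 / ‖c j‖ ^ 2 - 1 / ‖c k‖ ^ 2 < 0 :=
    sub_neg.mpr (one_div_lt_one_div_of_lt (by positivity) (by gcongr))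
  have : (∫ x, G x ∂haarTorus d) * (1 / ‖c j‖ ^ 2 - 1 / ‖c k‖ ^ 2) < 0 :=
    mul_neg_of_pos_of_neg (by linarith) hneg
  linarith

theorem continuous_projCoeff {p : ℝ} (hp : 2 < p) (j : Fin d) :
    Continuous fun c : Fin d → ℂ => projCoeff p c j := by
  have hg := continuous_powerMap hp
  have : Continuous (Function.uncurry fun (c : Fin d → ℂ) (x : Torus d) =>
      powerMap p (linearForm Finset.univ c x) * conj (fourier 1 (x j))) := by
    simp only [Function.uncurry_def, linearForm]
    fun_prop
  have h2 := continuous_parametric_integral_of_continuous (μ := haarTorus d) this isCompact_univ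
  simp only [Measure.restrict_univ] at h2
  exact h2

/-! ### The Riesz projection of `|φ|^{p-2} φ` -/

theorem orthonormal_monomial : Orthonormal ℂ (monomial (d := d)) :=
  UnitAddTorus.orthonormal_mFourier

theorem orthonormal_coordinate : Orthonormal ℂ (coordinate (d := d)) := by
  refine orthonormal_monomial.comp (fun j : Fin d => (Pi.single j 1 : Fin d → ℤ)) fun i j h => ?_
  by_contra hij
  have := congrFun h i
  simp [Pi.single_eq_of_ne hij] at this

theorem inner_eq_zero_of_monomial (f g : L2 d)
    (h : ∀ α, inner ℂ (monomial α) f = 0 ∨ inner ℂ (monomial α) g = 0) : inner ℂ f g = 0 := by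
  have hs := (UnitAddTorus.mFourierBasis (d := Fin d)).hasSum_inner_mul_inner f g
  refine hs.unique (hasSum_zero.congr_fun fun α => ?_)
  rw [UnitAddTorus.coe_mFourierBasis]
  rcases h α with h | h
  · have : inner ℂ f (monomial α) = 0 := by rw [← inner_conj_symm, h, map_zero]
    exact mul_eq_zero_of_left this _
  · exact mul_eq_zero_of_right _ h

/-- The `1`-homogeneous polynomial `∑ c_j z_j` in `L²`. -/
def polynomial (c : Fin d → ℂ) : L2 d := ∑ j, c j • coordinate j

theorem coeFn_polynomial (c : Fin d → ℂ) :
    (polynomial c : Torus d → ℂ) =ᵐ[haarTorus d] linearForm Finset.univ c := by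
  have h : polynomial c = ContinuousMap.toLp (E := ℂ) 2 (haarTorus d) ℂ
      (∑ j, c j • UnitAddTorus.mFourier (Pi.single j 1)) := by
    rw [map_sum]
    simp_rw [map_smul]
    rfl
  rw [h]
  refine (ContinuousMap.coeFn_toLp (haarTorus d) _).trans (Eventually.of_forall fun x => ?_)
  simp only [ContinuousMap.coe_sum, ContinuousMap.coe_smul, Finset.sum_apply, Pi.smul_apply,
    smul_eq_mul, linearForm, UnitAddTorus.mFourier_single]

theorem polynomial_mem_oneHomogeneous (c : Fin d → ℂ) : polynomial c ∈ oneHomogeneous d :=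
  Submodule.sum_mem _ fun j _ => Submodule.smul_mem _ _ (Submodule.subset_span ⟨j, rfl⟩)

theorem inner_coordinate_polynomial (c : Fin d → ℂ) (j : Fin d) :
    inner ℂ (coordinate j) (polynomial c) = c j :=
  orthonormal_coordinate.inner_right_fintype c j

theorem inner_monomial_polynomial (c : Fin d → ℂ) {α : Fin d → ℤ}
    (hα : ∀ j, α ≠ Pi.single j 1) : inner ℂ (monomial α) (polynomial c) = 0 := by
  unfold polynomial
  rw [inner_sum]
  refine Finset.sum_eq_zero fun j _ => ?_
  rw [inner_smul_right]
  exact mul_eq_zero_of_right _ (orthonormal_monomial.2 (hα j))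

theorem norm_sq_polynomial (c : Fin d → ℂ) : ‖polynomial c‖ ^ 2 = ∑ j, ‖c j‖ ^ 2 := by
  have h := orthonormal_coordinate.inner_sum c c Finset.univ
  have h2 : inner ℂ (polynomial c) (polynomial c) = ∑ j, conj (c j) * c j := h
  have h3 : ∀ j, conj (c j) * c j = ((‖c j‖ ^ 2 : ℝ) : ℂ) := fun j => by
    rw [mul_comm, Complex.mul_conj, Complex.normSq_eq_norm_sq]
  simp_rw [h3] at h2
  rw [← Complex.ofReal_sum] at h2
  rw [norm_sq_eq_re_inner (𝕜 := ℂ), h2]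
  exact Complex.ofReal_re _

theorem polynomial_mem_hardySpace (c : Fin d → ℂ) : polynomial c ∈ hardySpace d := by
  rintro α ⟨i, hi⟩
  rw [fourierCoefficient_eq_inner]
  refine inner_monomial_polynomial c fun j h => ?_
  rw [h] at hi
  by_cases hij : i = j
  · subst hij; simp at hi
  · simp [Pi.single_eq_of_ne hij] at hi

theorem mFourier_add_shift (α : Fin d → ℤ) (x : Torus d) (t : UnitAddCircle) :
    (UnitAddTorus.mFourier α (x + shift Finset.univ t) : ℂ) =
      fourier (∑ i, α i) t * UnitAddTorus.mFourier α x := by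
  have h1 : (fourier (∑ i, α i) t : ℂ) = ∏ i, fourier (α i) t := by
    induction (Finset.univ : Finset (Fin d)) using Finset.induction_on with
    | empty => simp
    | insert i s hi ih => rw [Finset.sum_insert hi, Finset.prod_insert hi, ← ih, fourier_add]
  have h2 : ∀ i, (fourier (α i) ((x + shift Finset.univ t : Torus d) i) : ℂ) =
      fourier (α i) t * fourier (α i) (x i) := by
    intro i
    simp only [Pi.add_apply, shift, Finset.mem_univ, if_true, fourier_apply, smul_add,
      AddCircle.toCircle_add, Circle.coe_mul]
    rw [mul_comm]
  simp only [UnitAddTorus.mFourier, ContinuousMap.coe_mk]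
  rw [h1, ← Finset.prod_mul_distrib]
  exact Finset.prod_congr rfl fun i _ => h2 i

theorem exists_fourier_ne_one {n : ℤ} (hn : n ≠ 0) : ∃ t : UnitAddCircle, (fourier n t : ℂ) ≠ 1 := by
  refine ⟨((1 / (2 * n) : ℝ) : AddCircle (1 : ℝ)), ?_⟩
  have : (n : ℂ) ≠ 0 := by exact_mod_cast hn
  have h : (fourier n ((1 / (2 * n) : ℝ) : AddCircle (1 : ℝ)) : ℂ) = -1 := by
    rw [fourier_coe_apply, ← Complex.exp_pi_mul_I]
    congr 1; push_cast; field_simp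
  rw [h]
  norm_num

/-- The Fourier coefficients of `|φ|^{p-2} φ` vanish off degree one. -/
theorem fourierCoefficient_powerMap_eq_zero (p : ℝ) (c : Fin d → ℂ) {α : Fin d → ℤ}
    (hα : ∑ i, α i ≠ 1) :
    fourierCoefficient (fun x => powerMap p (linearForm Finset.univ c x)) α = 0 := by
  unfold fourierCoefficient
  set I := ∫ x, powerMap p (linearForm Finset.univ c x) * conj (UnitAddTorus.mFourier α x)
    ∂haarTorus d with hI
  -- Rotating all variables by `t` multiplies the integrand by `fourier (1 - ∑ α_i) t`, which is not
  -- `1`, yet preserves the integral.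
  obtain ⟨t, ht⟩ := exists_fourier_ne_one (sub_ne_zero.mpr hα.symm)
  have h : I = fourier (1 - ∑ i, α i) t * I := by
    conv_lhs => rw [hI, ← integral_torus_add _ (shift Finset.univ t)]
    rw [hI, ← integral_const_mul]
    congr 1; ext x
    have h1 : conj (fourier (∑ i, α i) t : ℂ) = fourier (-∑ i, α i) t := by rw [fourier_neg]
    rw [mFourier_add_shift, linearForm_add_shift,
      powerMap_mul_of_norm_one p (norm_fourier_apply 1 t), sub_eq_add_neg, fourier_add, map_mul, h1]
    ring
  have h2 : (fourier (1 - ∑ i, α i) t - 1 : ℂ) * I = 0 := by linear_combination -h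
  exact (mul_eq_zero.mp h2).resolve_left (sub_ne_zero.mpr ht)

theorem eq_single_of_sum_eq_one {α : Fin d → ℤ} (h0 : ∀ j, 0 ≤ α j) (h1 : ∑ i, α i = 1) :
    ∃ j, α = Pi.single j 1 := by
  obtain ⟨j, hj⟩ : ∃ j, α j ≠ 0 := by
    by_contra! h
    simp [h] at h1
  have hs := Finset.add_sum_erase Finset.univ α (Finset.mem_univ j)
  have hr : 0 ≤ ∑ i ∈ Finset.univ.erase j, α i := Finset.sum_nonneg fun i _ => h0 i
  have hj1 : α j = 1 := by have := h0 j; omega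
  have hz : ∑ i ∈ Finset.univ.erase j, α i = 0 := by omega
  refine ⟨j, funext fun i => ?_⟩
  by_cases hij : i = j
  · subst hij; simp [hj1]
  · rw [Pi.single_eq_of_ne hij]
    exact (Finset.sum_eq_zero_iff_of_nonneg fun i _ => h0 i).mp hz i (by simp [hij])

theorem powerFunction_polynomial_ae (p : ℝ) (c : Fin d → ℂ) :
    powerFunction p (polynomial c : Torus d → ℂ) =ᵐ[haarTorus d]
      fun x => powerMap p (linearForm Finset.univ c x) := by
  filter_upwards [coeFn_polynomial c] with x hx
  simp only [powerFunction, powerMap, hx]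

theorem memLp_powerFunction {p : ℝ} (hp : 2 < p) (c : Fin d → ℂ) :
    MemLp (powerFunction p (polynomial c : Torus d → ℂ)) 2 (haarTorus d) := by
  have hg := continuous_powerMap hp
  rw [memLp_congr_ae (powerFunction_polynomial_ae p c)]
  exact Continuous.memLp_of_hasCompactSupport (by fun_prop) (HasCompactSupport.of_compactSpace _)

/-- An exponent with nonnegative entries and sum `1` is a unit vector, so the degree-one
coefficients that survive the projection are exactly those of the `z_j`. -/
theorem rieszProjection_powerFunction {p : ℝ} (hp : 2 < p) (c : Fin d → ℂ) :
    rieszProjection d ((memLp_powerFunction hp c).toLp _) = polynomial (projCoeff p c) := by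
  set F := (memLp_powerFunction hp c).toLp _ with hF
  have hcoef : ∀ α, inner ℂ (monomial α) F =
      fourierCoefficient (fun x => powerMap p (linearForm Finset.univ c x)) α := by
    intro α
    rw [← fourierCoefficient_eq_inner]
    refine integral_congr_ae ?_
    filter_upwards [(memLp_powerFunction hp c).coeFn_toLp, powerFunction_polynomial_ae p c]
      with x h1 h2
    rw [hF, h1, h2]
  refine Submodule.eq_starProjection_of_mem_of_inner_eq_zero
    (polynomial_mem_hardySpace _) fun g hg => ?_
  refine inner_eq_zero_of_monomial _ _ fun α => ?_
  by_cases hneg : ∃ j, α j < 0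
  · right
    rw [← fourierCoefficient_eq_inner]
    exact hg α hneg
  · left
    push Not at hneg
    rw [inner_sub_right, hcoef]
    by_cases h1 : ∑ i, α i = 1
    · obtain ⟨j, rfl⟩ := eq_single_of_sum_eq_one hneg h1
      rw [sub_eq_zero]
      refine Eq.trans ?_ (inner_coordinate_polynomial _ j).symm
      simp only [fourierCoefficient, projCoeff, UnitAddTorus.mFourier_single]
    · rw [fourierCoefficient_powerMap_eq_zero p c h1, inner_monomial_polynomial, sub_zero]
      rintro j rfl
      simp at h1

/-! ### The normalized map on coefficients -/

/-- The nonlinear projection on coefficients. -/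
def coeffMap (p : ℝ) (c : Fin d → ℂ) : Fin d → ℂ :=
  fun j => ((‖polynomial (projCoeff p c)‖⁻¹ : ℝ) : ℂ) * projCoeff p c j

theorem nonlinearProjection_polynomial {p : ℝ} (hp : 2 < p) (c : Fin d → ℂ) :
    nonlinearProjection p (polynomial c) = polynomial (coeffMap p c) := by
  unfold nonlinearProjection
  rw [dif_pos (memLp_powerFunction hp c), rieszProjection_powerFunction hp]
  simp only [polynomial, coeffMap, Finset.smul_sum, smul_smul]

theorem continuous_polynomial : Continuous (polynomial (d := d)) := by
  unfold polynomial
  fun_prop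

theorem polynomial_smul (a : ℂ) (c : Fin d → ℂ) :
    polynomial (fun j => a * c j) = a • polynomial c := by
  simp only [polynomial, Finset.smul_sum, smul_smul]

theorem polynomial_projCoeff_ne_zero {p : ℝ} (hp : 2 < p) {c : Fin d → ℂ} {j : Fin d}
    (hj : c j ≠ 0) : polynomial (projCoeff p c) ≠ 0 := by
  intro h
  have h1 := inner_coordinate_polynomial (projCoeff p c) j
  rw [h, inner_zero_right, projCoeff_eq hp] at h1
  have : (growthFactor p c j : ℂ) ≠ 0 := by exact_mod_cast (growthFactor_pos hp hj).ne'
  exact mul_ne_zero hj this h1.symm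

theorem norm_polynomial_coeffMap {p : ℝ} (hp : 2 < p) {c : Fin d → ℂ} {j : Fin d}
    (hj : c j ≠ 0) : ‖polynomial (coeffMap p c)‖ = 1 := by
  have h := norm_ne_zero_iff.mpr (polynomial_projCoeff_ne_zero hp hj)
  unfold coeffMap
  rw [polynomial_smul, norm_smul, Complex.norm_real, norm_inv, norm_norm, inv_mul_cancel₀ h]

/-- The factor by which the `j`-th coefficient is multiplied by the normalized map. -/
def normalizedFactor (p : ℝ) (c : Fin d → ℂ) (j : Fin d) : ℝ :=
  ‖polynomial (projCoeff p c)‖⁻¹ * growthFactor p c j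

theorem coeffMap_eq {p : ℝ} (hp : 2 < p) (c : Fin d → ℂ) (j : Fin d) :
    coeffMap p c j = normalizedFactor p c j * c j := by
  unfold coeffMap normalizedFactor
  rw [projCoeff_eq hp]
  push_cast
  ring

theorem normalizedFactor_pos {p : ℝ} (hp : 2 < p) {c : Fin d → ℂ} {j : Fin d} (hj : c j ≠ 0) :
    0 < normalizedFactor p c j :=
  mul_pos (inv_pos.mpr (norm_pos_iff.mpr (polynomial_projCoeff_ne_zero hp hj)))
    (growthFactor_pos hp hj)

theorem norm_coeffMap {p : ℝ} (hp : 2 < p) {c : Fin d → ℂ} {j : Fin d} (hj : c j ≠ 0) :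
    ‖coeffMap p c j‖ = normalizedFactor p c j * ‖c j‖ := by
  rw [coeffMap_eq hp, norm_mul, Complex.norm_real,
    Real.norm_of_nonneg (normalizedFactor_pos hp hj).le]

theorem coeffMap_ne_zero {p : ℝ} (hp : 2 < p) {c : Fin d → ℂ} {j : Fin d} (hj : c j ≠ 0) :
    coeffMap p c j ≠ 0 := by
  rw [coeffMap_eq hp]
  exact mul_ne_zero (by exact_mod_cast (normalizedFactor_pos hp hj).ne') hj

theorem coeffMap_div_norm {p : ℝ} (hp : 2 < p) {c : Fin d → ℂ} {j : Fin d} (hj : c j ≠ 0) :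
    coeffMap p c j / (‖coeffMap p c j‖ : ℂ) = c j / (‖c j‖ : ℂ) := by
  rw [norm_coeffMap hp hj, coeffMap_eq hp]
  have : (normalizedFactor p c j : ℂ) ≠ 0 := by
    exact_mod_cast (normalizedFactor_pos hp hj).ne'
  push_cast
  rw [mul_div_mul_left _ _ this]

theorem norm_coeffMap_le {p : ℝ} (hp : 2 < p) {c : Fin d → ℂ} {j k : Fin d} (hj : c j ≠ 0)
    (hk : c k ≠ 0) (h : ‖c k‖ ≤ ‖c j‖) : ‖coeffMap p c k‖ ≤ ‖coeffMap p c j‖ := by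
  rw [norm_coeffMap hp hj, norm_coeffMap hp hk]
  unfold normalizedFactor
  have := mul_le_mul_of_nonneg_left (norm_mul_growthFactor_le hp hj hk h)
    (inv_nonneg.mpr (norm_nonneg (polynomial (projCoeff p c))))
  linarith

theorem coeffMap_ratio_lt {p : ℝ} (hp : 2 < p) {c : Fin d → ℂ} {j k : Fin d}
    (hk : c k ≠ 0) (h : ‖c k‖ < ‖c j‖) :
    ‖coeffMap p c j‖ / ‖coeffMap p c k‖ < ‖c j‖ / ‖c k‖ := by
  have hk0 : 0 < ‖c k‖ := norm_pos_iff.mpr hk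
  have hj : c j ≠ 0 := norm_pos_iff.mp (hk0.trans h)
  have hlt : normalizedFactor p c j < normalizedFactor p c k :=
    mul_lt_mul_of_pos_left (growthFactor_lt hp hk h)
      (inv_pos.mpr (norm_pos_iff.mpr (polynomial_projCoeff_ne_zero hp hj)))
  have hfk := normalizedFactor_pos hp hk
  rw [norm_coeffMap hp hj, norm_coeffMap hp hk, div_lt_div_iff₀ (by positivity) hk0]
  have : 0 < ‖c j‖ * ‖c k‖ := mul_pos (hk0.trans h) hk0
  nlinarith

theorem coeffMap_ratio_le {p : ℝ} (hp : 2 < p) {c : Fin d → ℂ} {j k : Fin d}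
    (hk : c k ≠ 0) (h : ‖c k‖ ≤ ‖c j‖) :
    ‖coeffMap p c j‖ / ‖coeffMap p c k‖ ≤ ‖c j‖ / ‖c k‖ := by
  have hk0 : 0 < ‖c k‖ := norm_pos_iff.mpr hk
  rcases h.eq_or_lt with h | h
  · have hj : c j ≠ 0 := norm_pos_iff.mp (h ▸ hk0)
    rw [h, div_self (h ▸ hk0).ne']
    -- For equal moduli, order preservation is applied with `j` and `k` exchanged.
    exact div_le_one_of_le₀ (norm_coeffMap_le hp hk hj h.ge) (norm_nonneg _)
  · exact (coeffMap_ratio_lt hp hk h).le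

theorem continuousAt_coeffMap {p : ℝ} (hp : 2 < p) {c : Fin d → ℂ} {j : Fin d} (hj : c j ≠ 0) :
    ContinuousAt (coeffMap p) c := by
  have h1 : Continuous fun c : Fin d → ℂ => projCoeff p c :=
    continuous_pi fun j => continuous_projCoeff hp j
  have h2 : ContinuousAt (fun c : Fin d → ℂ => ‖polynomial (projCoeff p c)‖⁻¹) c :=
    (continuous_polynomial.comp h1).norm.continuousAt.inv₀
      (norm_ne_zero_iff.mpr (polynomial_projCoeff_ne_zero hp hj))
  refine continuousAt_pi.mpr fun i => ?_
  exact (Complex.continuous_ofReal.continuousAt.comp h2).mul (continuous_projCoeff hp i).continuousAt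

/-! ### Convergence of the iterates -/

section Iterates

variable {p : ℝ} (hp : 2 < p) {c : Fin d → ℂ} (hc : ∀ j, c j ≠ 0)
include hp hc

theorem iterate_coeffMap_ne_zero (n : ℕ) (j : Fin d) : (coeffMap p)^[n] c j ≠ 0 := by
  induction n with
  | zero => exact hc j
  | succ n ih => rw [Function.iterate_succ_apply']; exact coeffMap_ne_zero hp ih

theorem iterate_coeffMap_div_norm (n : ℕ) (j : Fin d) :
    (coeffMap p)^[n] c j / (‖(coeffMap p)^[n] c j‖ : ℂ) = c j / (‖c j‖ : ℂ) := by
  induction n with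
  | zero => rfl
  | succ n ih =>
    rw [Function.iterate_succ_apply', coeffMap_div_norm hp (iterate_coeffMap_ne_zero hp hc n j), ih]

theorem norm_iterate_coeffMap_le {j k : Fin d} (h : ‖c k‖ ≤ ‖c j‖) (n : ℕ) :
    ‖(coeffMap p)^[n] c k‖ ≤ ‖(coeffMap p)^[n] c j‖ := by
  induction n with
  | zero => exact h
  | succ n ih =>
    rw [Function.iterate_succ_apply']
    exact norm_coeffMap_le hp (iterate_coeffMap_ne_zero hp hc n j)
      (iterate_coeffMap_ne_zero hp hc n k) ih

theorem antitone_iterate_ratio {j k : Fin d} (h : ‖c k‖ ≤ ‖c j‖) :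
    Antitone fun n => ‖(coeffMap p)^[n] c j‖ / ‖(coeffMap p)^[n] c k‖ := by
  refine antitone_nat_of_succ_le fun n => ?_
  simp only [Function.iterate_succ_apply']
  exact coeffMap_ratio_le hp (iterate_coeffMap_ne_zero hp hc n k)
    (norm_iterate_coeffMap_le hp hc h n)

/-- The constant is independent of `n`, so if one coefficient of a cluster point vanished, all
would, against the unit norm. -/
theorem norm_iterate_coeffMap_le_mul (j k : Fin d) (n : ℕ) :
    ‖(coeffMap p)^[n] c j‖ ≤ max 1 (‖c j‖ / ‖c k‖) * ‖(coeffMap p)^[n] c k‖ := by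
  rcases le_total ‖c k‖ ‖c j‖ with h | h
  · have h1 := antitone_iterate_ratio hp hc h (Nat.zero_le n)
    simp only [Function.iterate_zero, id] at h1
    rw [div_le_iff₀ (norm_pos_iff.mpr (iterate_coeffMap_ne_zero hp hc n k))] at h1
    exact h1.trans (by gcongr; exact le_max_right _ _)
  · refine (norm_iterate_coeffMap_le hp hc h n).trans (le_mul_of_one_le_left (norm_nonneg _) ?_)
    exact le_max_left _ _

theorem norm_polynomial_iterate (h1 : ‖polynomial c‖ = 1) (n : ℕ) :
    ‖polynomial ((coeffMap p)^[n] c)‖ = 1 := by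
  cases n with
  | zero => exact h1
  | succ n =>
    -- For `d = 0` the polynomial is zero, which the unit norm excludes.
    obtain ⟨j⟩ : Nonempty (Fin d) := by
      by_contra h
      rw [not_nonempty_iff] at h
      have : polynomial c = 0 := by simp [polynomial]
      rw [this, norm_zero] at h1
      exact zero_ne_one h1
    rw [Function.iterate_succ_apply']
    exact norm_polynomial_coeffMap hp (iterate_coeffMap_ne_zero hp hc n j)

theorem sum_sq_iterate (h1 : ‖polynomial c‖ = 1) (n : ℕ) :
    ∑ j, ‖(coeffMap p)^[n] c j‖ ^ 2 = 1 := by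
  rw [← norm_sq_polynomial, norm_polynomial_iterate hp hc h1, one_pow]

/-- The iterates have a cluster point, and all its coefficients are nonzero. -/
theorem exists_subseq_tendsto (h1 : ‖polynomial c‖ = 1) :
    ∃ (a : Fin d → ℂ) (φ : ℕ → ℕ), StrictMono φ ∧ (∀ j, a j ≠ 0) ∧
      Tendsto (fun n => (coeffMap p)^[φ n] c) atTop (𝓝 a) := by
  have hmem : ∀ n, (coeffMap p)^[n] c ∈ Metric.closedBall (0 : Fin d → ℂ) 1 := by
    intro n
    rw [mem_closedBall_zero_iff, pi_norm_le_iff_of_nonneg zero_le_one]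
    intro j
    have h2 := Finset.single_le_sum (f := fun j => ‖(coeffMap p)^[n] c j‖ ^ 2)
      (fun i _ => sq_nonneg _) (Finset.mem_univ j)
    rw [sum_sq_iterate hp hc h1] at h2
    exact (sq_le_one_iff₀ (norm_nonneg _)).mp h2
  obtain ⟨a, -, φ, hφ, hlim⟩ := (isCompact_closedBall (0 : Fin d → ℂ) 1).tendsto_subseq hmem
  refine ⟨a, φ, hφ, fun k hk => ?_, hlim⟩
  have hj : ∀ j, Tendsto (fun n => ‖(coeffMap p)^[φ n] c j‖) atTop (𝓝 ‖a j‖) := fun j =>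
    (tendsto_pi_nhds.mp hlim j).norm
  have hz : ∀ j, ‖a j‖ = 0 := by
    intro j
    have := le_of_tendsto_of_tendsto (hj j) ((hj k).const_mul (max 1 (‖c j‖ / ‖c k‖)))
      (Eventually.of_forall fun n => norm_iterate_coeffMap_le_mul hp hc j k (φ n))
    rw [hk, norm_zero, mul_zero] at this
    exact le_antisymm this (norm_nonneg _)
  have hs : Tendsto (fun n => ∑ j, ‖(coeffMap p)^[φ n] c j‖ ^ 2) atTop (𝓝 (∑ j, ‖a j‖ ^ 2)) :=
    tendsto_finsetSum _ fun j _ => (hj j).pow 2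
  simp only [sum_sq_iterate hp hc h1, hz] at hs
  have := tendsto_nhds_unique tendsto_const_nhds hs
  simp at this

theorem tendsto_iterate_ratio_of_le (h1 : ‖polynomial c‖ = 1) {j k : Fin d} (h : ‖c k‖ ≤ ‖c j‖) :
    Tendsto (fun n => ‖(coeffMap p)^[n] c j‖ / ‖(coeffMap p)^[n] c k‖) atTop (𝓝 1) := by
  set r : ℕ → ℝ := fun n => ‖(coeffMap p)^[n] c j‖ / ‖(coeffMap p)^[n] c k‖ with hr
  have hge : ∀ n, 1 ≤ r n := fun n => by
    rw [hr, one_le_div (norm_pos_iff.mpr (iterate_coeffMap_ne_zero hp hc n k))]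
    exact norm_iterate_coeffMap_le hp hc h n
  have hanti : Antitone r := antitone_iterate_ratio hp hc h
  have hlim : Tendsto r atTop (𝓝 (⨅ n, r n)) :=
    tendsto_atTop_ciInf hanti ⟨1, by rintro _ ⟨n, rfl⟩; exact hge n⟩
  set l := ⨅ n, r n with hl
  have hl1 : 1 ≤ l := le_ciInf hge
  rcases hl1.eq_or_lt with h2 | h2
  · rwa [← h2] at hlim
  exfalso
  obtain ⟨a, φ, hφ, ha, hconv⟩ := exists_subseq_tendsto hp hc h1
  have hratio : ∀ {b : ℕ → Fin d → ℂ} {b' : Fin d → ℂ}, Tendsto b atTop (𝓝 b') → b' k ≠ 0 →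
      Tendsto (fun n => ‖b n j‖ / ‖b n k‖) atTop (𝓝 (‖b' j‖ / ‖b' k‖)) := by
    intro b b' hb hk
    exact (tendsto_pi_nhds.mp hb j).norm.div (tendsto_pi_nhds.mp hb k).norm
      (norm_ne_zero_iff.mpr hk)
  have e1 : ‖a j‖ / ‖a k‖ = l :=
    tendsto_nhds_unique (hratio hconv (ha k)) (hlim.comp hφ.tendsto_atTop)
  -- By continuity at `a`, the subsequence shifted by one step tends to the image of `a`; the ratio
  -- there has the same limit `l`, against strict decrease when `l > 1`.
  have e2 : ‖coeffMap p a j‖ / ‖coeffMap p a k‖ = l := by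
    have h3 : Tendsto (fun n => (coeffMap p)^[φ n + 1] c) atTop (𝓝 (coeffMap p a)) := by
      simp only [Function.iterate_succ_apply']
      exact (continuousAt_coeffMap hp (ha k)).tendsto.comp hconv
    exact tendsto_nhds_unique (hratio h3 (coeffMap_ne_zero hp (ha k)))
      (hlim.comp ((tendsto_add_atTop_nat 1).comp hφ.tendsto_atTop))
  have h3 : ‖a k‖ < ‖a j‖ := by
    rw [← e1, one_lt_div (norm_pos_iff.mpr (ha k))] at h2
    exact h2
  have := coeffMap_ratio_lt hp (ha k) h3
  rw [e1, e2] at this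
  exact lt_irrefl _ this

theorem tendsto_iterate_ratio (h1 : ‖polynomial c‖ = 1) (j k : Fin d) :
    Tendsto (fun n => ‖(coeffMap p)^[n] c j‖ / ‖(coeffMap p)^[n] c k‖) atTop (𝓝 1) := by
  rcases le_total ‖c k‖ ‖c j‖ with h | h
  · exact tendsto_iterate_ratio_of_le hp hc h1 h
  · have := (tendsto_iterate_ratio_of_le hp hc h1 h).inv₀ one_ne_zero
    simpa only [inv_div, inv_one] using this

theorem tendsto_norm_iterate (h1 : ‖polynomial c‖ = 1) (j : Fin d) :
    Tendsto (fun n => ‖(coeffMap p)^[n] c j‖) atTop (𝓝 (1 / √d)) := by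
  -- By the unit norm this sum is the inverse square of the `j`-th modulus.
  have hs : Tendsto (fun n => ∑ i, (‖(coeffMap p)^[n] c i‖ / ‖(coeffMap p)^[n] c j‖) ^ 2) atTop
      (𝓝 (d : ℝ)) := by
    have := tendsto_finsetSum Finset.univ fun i _ => (tendsto_iterate_ratio hp hc h1 i j).pow 2
    simpa using this
  have hd : (d : ℝ) ≠ 0 := by exact_mod_cast (Fin.pos j).ne'
  have h2 := (tendsto_const_nhds (x := (1 : ℝ))).div hs.sqrt ((Real.sqrt_ne_zero (Nat.cast_nonneg d)).mpr hd)
  refine h2.congr fun n => ?_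
  simp only [Pi.div_apply]
  have hj := norm_pos_iff.mpr (iterate_coeffMap_ne_zero hp hc n j)
  simp_rw [div_pow]
  rw [← Finset.sum_div, sum_sq_iterate hp hc h1, Real.sqrt_div zero_le_one, Real.sqrt_one,
    Real.sqrt_sq hj.le, one_div_one_div]

theorem tendsto_iterate_coeffMap (h1 : ‖polynomial c‖ = 1) :
    Tendsto (fun n => (coeffMap p)^[n] c) atTop
      (𝓝 fun j => ((1 / √d : ℝ) : ℂ) * (c j / (‖c j‖ : ℂ))) := by
  refine tendsto_pi_nhds.mpr fun j => ?_
  have h2 := ((Complex.continuous_ofReal.tendsto _).comp (tendsto_norm_iterate hp hc h1 j)).mul_const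
    (c j / (‖c j‖ : ℂ))
  refine h2.congr fun n => ?_
  have hj : (‖(coeffMap p)^[n] c j‖ : ℂ) ≠ 0 := by
    simpa using iterate_coeffMap_ne_zero hp hc n j
  rw [← iterate_coeffMap_div_norm hp hc n j, Function.comp_apply, mul_div_cancel₀ _ hj]

end Iterates

theorem iterate_nonlinearProjection {p : ℝ} (hp : 2 < p) (c : Fin d → ℂ) (n : ℕ) :
    (nonlinearProjection p)^[n] (polynomial c) = polynomial ((coeffMap p)^[n] c) := by
  induction n with
  | zero => rfl
  | succ n ih => rw [Function.iterate_succ_apply', ih, nonlinearProjection_polynomial hp,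
      Function.iterate_succ_apply']

end HilbertPoints

end

theorem mainTheorem8 (d : ℕ) (p : ℝ) (hp : 2 < p) (c : Fin d → ℂ) (hc : ∀ j, c j ≠ 0)
    (φ₀ : HilbertPoints.L2 d) (hφ₀ : φ₀ = ∑ j, c j • HilbertPoints.coordinate j)
    (hnorm : ‖φ₀‖ = 1) :
    (∀ n : ℕ, (HilbertPoints.nonlinearProjection p)^[n] φ₀ ∈ HilbertPoints.oneHomogeneous d ∧
      ‖(HilbertPoints.nonlinearProjection p)^[n] φ₀‖ = 1) ∧
    Tendsto (fun n : ℕ => (HilbertPoints.nonlinearProjection p)^[n] φ₀) atTop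
      (𝓝 (((1 / Real.sqrt d : ℝ) : ℂ) •
        ∑ j, (c j / (‖c j‖ : ℂ)) • HilbertPoints.coordinate j)) := by
  obtain rfl : φ₀ = HilbertPoints.polynomial c := hφ₀
  simp_rw [HilbertPoints.iterate_nonlinearProjection hp]
  refine ⟨fun n => ⟨HilbertPoints.polynomial_mem_oneHomogeneous _,
    HilbertPoints.norm_polynomial_iterate hp hc hnorm n⟩, ?_⟩
  have h := (HilbertPoints.continuous_polynomial.tendsto _).comp
    (HilbertPoints.tendsto_iterate_coeffMap hp hc hnorm)
  rw [HilbertPoints.polynomial_smul] at h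
  exact h
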